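/- Let $n\ge 0$ be an integer, let $\Theta$ be a (symmetric) positive definite real $n\times n$ matrix, and let $(\Omega,\mathcal F,\mathbb P)$ be a probability space. Let $G=(G_t)_{t\in\mathbb R}$ be a centred $\mathbb R^n$-valued process with strictly stationary increments, almost surely continuous paths, $G_0=0$ a.s., and $\sup_{s\in[0,1]}\mathbb E[(G^{(i)}_s)^2]<\infty$ for $i=1,\dots,n$. Let $U=(U_t)_{t\in\mathbb R}$ be the solution, with almost surely continuous paths, of the Langevin equation $$dU_t=-\Theta U_t\,dt+dG_t,\quad t\in\mathbb R,\qquad U_0=\int_{-\infty}^0 e^{\Theta s}\,dG_s ,$$ where the equation is understood pathwise in integrated form and $\int_{-\infty}^{0}e^{\Theta s}dG_s := G_0-\Theta\lim_{r\to-\infty}\int_r^0 e^{\Theta s}G_s\,ds$ almost surely. Put $\gamma(s)=\mathbb E[U_sU_0^\top]$ and fix $t\ge 0$. Let $$B=\int_0^t(\gamma(s)-\gamma(s)^\top)\,ds,\quad C=\int_0^t\!\!\int_0^t\gamma(s-u)\,du\,ds,\quad D=\mathrm{cov}(G_t)-\mathrm{cov}(U_t-U_0),$$ and assume that $C$ and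 $D$ are positive definite. For $T>0$ let $\hat\gamma_T$ be an estimator of $\gamma$ on $[-t,t]$, that is, a random matrix-valued function whose entries are integrable on $[0,t]$ and which satisfies $\hat\gamma_T(-s)=\hat\gamma_T(s)^\top$ for $s\in[0,t]$ (in particular $\hat\gamma_T(0)$ is symmetric). Here these properties of $\hat\gamma_T$ are required almost surely for each $T>0$ in (i), and almost surely for all $T>0$ simultaneously in (ii). Let $$\hat B_T=\int_0^t(\hat\gamma_T(s)-\hat\gamma_T(s)^\top)\,ds,\quad \hat C_T=\int_0^t\!\!\int_0^t\hat\gamma_T(s-u)\,du\,ds,\quad \hat D_T=\mathrm{cov}(G_t)-\bigl(2\hat\gamma_T(0)-\hat\gamma_T(t)-\hat\gamma_T(t)^\top\bigr).$$ Let $\hat\Theta_T$ be the unique positive semidefinite solution $X$ of $$\hat B_T^\top X+X\hat B_T-X\hat C_TX+\hat D_T=0$$ if there is exactly one such solution, and $\hat\Theta_T=0$ otherwise. Let $\|\cdot\|$ be the spectral norm. Then, as $T\to\infty$: (i) if $\sup_{s\in[0,t]}\|\hat\gamma_T(s)-\gamma(s)\|\to0$ in probability, then $\|\hat\Theta_T-\Theta\|\to0$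 in probability; (ii) if $\sup_{s\in[0,t]}\|\hat\gamma_T(s)-\gamma(s)\|\to0$ almost surely, then $\|\hat\Theta_T-\Theta\|\to0$ almost surely. -/

import Mathlib

open MeasureTheory ProbabilityTheory Filter Topology Set
open scoped Matrix Matrix.Norms.L2Operator ENNReal

noncomputable section

namespace Langevin

variable {n : ℕ} {Ω : Type*} [MeasurableSpace Ω]

/-- `v = ∫_{-∞}^t e^{Θ u} dx_u`, read through integration by parts:
`e^{Θ t} x_t - Θ lim_{s → -∞} ∫_s^t e^{Θ u} x_u du`, the limit being required to exist. -/
def HasExpIntegral (Θ : Matrix (Fin n) (Fin n) ℝ) (x : ℝ → Fin n → ℝ) (t : ℝ)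
    (v : Fin n → ℝ) : Prop :=
  ∃ L : Fin n → ℝ,
    Tendsto (fun s : ℝ => ∫ u in s..t, NormedSpace.exp (u • Θ) *ᵥ x u) atBot (𝓝 L) ∧
      v = NormedSpace.exp (t • Θ) *ᵥ x t - Θ *ᵥ L

/-- The driving noise: a centred process with strictly stationary increments, almost surely
continuous paths, `G_0 = 0` and `sup_{s ∈ [0,1]} E[(G_s^{(i)})^2] < ∞` for every `i`. -/
structure IsDriver (P : Measure Ω) (G : ℝ → Ω → Fin n → ℝ) : Prop where
  measurable : ∀ t, Measurable (G t)
  zero : ∀ᵐ ω ∂P, G 0 ω = 0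
  continuous : ∀ᵐ ω ∂P, Continuous fun t => G t ω
  stationary_increments : ∀ (m : ℕ) (τ : Fin m → ℝ) (h : ℝ),
    IdentDistrib (fun ω k => G (τ k + h) ω - G h ω) (fun ω k => G (τ k) ω - G 0 ω) P P
  second_moment : ∀ i, (⨆ s ∈ Icc (0 : ℝ) 1, ∫⁻ ω, ‖G s ω i‖ₑ ^ 2 ∂P) < ∞
  centred : ∀ t i, ∫ ω, G t ω i ∂P = 0

/-- `U` solves `dU_t = -Θ U_t dt + dG_t`, `t ∈ ℝ`, with initial value
`U_0 = ∫_{-∞}^0 e^{Θ s} dG_s`. -/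
structure IsSolution (P : Measure Ω) (Θ : Matrix (Fin n) (Fin n) ℝ)
    (G U : ℝ → Ω → Fin n → ℝ) : Prop where
  measurable : ∀ t, Measurable (U t)
  continuous : ∀ᵐ ω ∂P, Continuous fun t => U t ω
  equation : ∀ᵐ ω ∂P, ∀ s t : ℝ,
    U t ω - U s ω = -(Θ *ᵥ ∫ u in s..t, U u ω) + (G t ω - G s ω)
  initial : ∀ᵐ ω ∂P, HasExpIntegral Θ (fun s => G s ω) 0 (U 0 ω)

/-- The cross-covariance matrix `γ(t) = E[U_t U_0ᵀ]`. -/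
def crossCov (P : Measure Ω) (U : ℝ → Ω → Fin n → ℝ) (t : ℝ) : Matrix (Fin n) (Fin n) ℝ :=
  Matrix.of fun i j => ∫ ω, U t ω i * U 0 ω j ∂P

/-- The covariance matrix of a random vector. -/
def covMatrix (P : Measure Ω) (X : Ω → Fin n → ℝ) : Matrix (Fin n) (Fin n) ℝ :=
  Matrix.of fun i j => cov[fun ω => X ω i, fun ω => X ω j; P]

/-- `∫_0^t (g(s) - g(s)ᵀ) ds`. -/
def coeffB (t : ℝ) (g : ℝ → Matrix (Fin n) (Fin n) ℝ) : Matrix (Fin n) (Fin n) ℝ :=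
  Matrix.of fun i j => ∫ s in (0 : ℝ)..t, (g s i j - g s j i)

/-- `∫_0^t ∫_0^t g(s - u) du ds`. -/
def coeffC (t : ℝ) (g : ℝ → Matrix (Fin n) (Fin n) ℝ) : Matrix (Fin n) (Fin n) ℝ :=
  Matrix.of fun i j => ∫ s in (0 : ℝ)..t, ∫ u in (0 : ℝ)..t, g (s - u) i j

/-- `cov(G_t) - cov(U_t - U_0)`. -/
def coeffD (P : Measure Ω) (G U : ℝ → Ω → Fin n → ℝ) (t : ℝ) : Matrix (Fin n) (Fin n) ℝ :=
  covMatrix P (G t) - covMatrix P (fun ω => U t ω - U 0 ω)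

/-- The estimated counterpart of `cov(G_t) - cov(U_t - U_0)`: for the stationary centred `U`,
`cov(U_t - U_0) = 2 γ(0) - γ(t) - γ(t)ᵀ`, and `γ` is replaced by its estimate `g`. -/
def estCoeffD (P : Measure Ω) (G : ℝ → Ω → Fin n → ℝ) (t : ℝ)
    (g : ℝ → Matrix (Fin n) (Fin n) ℝ) : Matrix (Fin n) (Fin n) ℝ :=
  covMatrix P (G t) - ((2 : ℝ) • g 0 - g t - (g t)ᵀ)

/-- `X` is a positive semidefinite solution of `Bᵀ X + X B - X C X + D = 0`. -/
def IsPSDRiccatiSolution (B C D X : Matrix (Fin n) (Fin n) ℝ) : Prop :=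
  X.PosSemidef ∧ Bᵀ * X + X * B - X * C * X + D = 0

open Classical in
/-- The positive semidefinite solution of `Bᵀ X + X B - X C X + D = 0` if there is exactly
one, and `0` otherwise. -/
def riccatiSolution (B C D : Matrix (Fin n) (Fin n) ℝ) : Matrix (Fin n) (Fin n) ℝ :=
  if h : ∃! X, IsPSDRiccatiSolution B C D X then h.choose else 0

/-- The estimator of `Θ` obtained from the estimate `g` of the cross-covariance function. -/
def thetaEstimator (P : Measure Ω) (G : ℝ → Ω → Fin n → ℝ) (t : ℝ)
    (g : ℝ → Matrix (Fin n) (Fin n) ℝ) : Matrix (Fin n) (Fin n) ℝ :=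
  riccatiSolution (coeffB t g) (coeffC t g) (estCoeffD P G t g)

/-- Standing conventions on a realised estimate `g` of a cross-covariance function on
`[-t, t]`: its entries are integrable, so that the coefficient integrals make sense, and
negative lags are given by transposition, as for the cross-covariance itself. -/
structure IsCovEstimate (t : ℝ) (g : ℝ → Matrix (Fin n) (Fin n) ℝ) : Prop where
  integrable : ∀ i j, IntervalIntegrable (fun s => g s i j) volume 0 t
  neg_lag : ∀ s ∈ Icc (0 : ℝ) t, g (-s) = (g s)ᵀ

/-- `sup_{s ∈ [0,t]} ‖g(s) - γ(s)‖` in `[0, ∞]`, with the spectral norm. -/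
def supError (t : ℝ) (g γ : ℝ → Matrix (Fin n) (Fin n) ℝ) : ℝ≥0∞ :=
  ⨆ s ∈ Icc (0 : ℝ) t, ‖g s - γ s‖ₑ

end Langevin

end

/-!
The estimator is a continuous function of the estimated cross-covariance, and `Θ` is its value at
the true one; both modes of convergence follow from this deterministic continuity.

**`Θ` solves the Riccati equation** (`IsSolution.isPSDRiccatiSolution`). Since
`G_t = (U_t - U_0) + Θ ∫_0^t U_s ds`, taking second moments of both sides gives
`cov(G_t) = cov(U_t - U_0) - Bᵀ Θ - Θ B + Θ C Θ`, once `U` is known to be square integrable with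
shift invariant second moments. Both facts come from the representation
`U_t = -Θ ∫_{-∞}^0 e^{Θ u} (G_{t+u} - G_t) du` (`tendsto_integral_exp_increment`), which exhibits
`U` as an almost sure limit of Riemann sums of increments of `G`. Equality in law passes to the
limit (`IsSolution.stationary`). The `L²` norm of `G` grows at most linearly while `e^{Θ u}` decays
exponentially at `-∞`, so Fatou's lemma gives square integrability (`IsSolution.memLp_zero`).

**The Riccati solution is unique and continuous in the coefficients**
(`tendsto_riccatiSolution`). If `C` and `D` are positive definite, a positive semidefinite solution
`X` is positive definite, and it is a strict Lyapunov function for its closed loop matrix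
`B - C X`. A Sylvester equation whose two coefficients admit such Lyapunov functions has only the
zero solution, by a trace argument (`sylvester_eq_zero`). Applied to the difference of two solutions
this gives uniqueness. Applied to the derivative of the Riccati map in `X` it gives invertibility,
and the implicit function theorem then produces a solution near `X` for all nearby coefficients;
it is symmetric by local uniqueness, hence positive definite.

**The coefficients depend continuously on the estimate.** They are integrals of bounded length of
the estimate, so they differ from the true ones by a multiple of `supError`; the convention
`g(-s) = g(s)ᵀ` controls negative lags and makes the estimated `C` and `D` symmetric.
-/

noncomputable section

namespace Langevin

/-! ### Positive definiteness and the Sylvester equation -/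

open scoped MatrixOrder in
/-- Pairing with a positive definite matrix under the trace is a faithful positive functional on
the positive semidefinite cone. -/
lemma trace_mul_posDef_faithful {n : ℕ} {Z P : Matrix (Fin n) (Fin n) ℝ} (hZ : Z.PosDef)
    (hP : P.PosSemidef) : 0 ≤ (Z * P).trace ∧ ((Z * P).trace = 0 → P = 0) := by
  obtain ⟨S, hS⟩ := CStarAlgebra.nonneg_iff_eq_star_mul_self.mp hZ.posSemidef.nonneg
  rw [Matrix.star_eq_conjTranspose] at hS
  have hSu : IsUnit S := by
    have h := hZ.isUnit
    rw [hS, Matrix.isUnit_iff_isUnit_det, Matrix.det_mul] at h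
    rw [Matrix.isUnit_iff_isUnit_det]
    exact isUnit_of_mul_isUnit_right h
  have hpsd : (S * P * Sᴴ).PosSemidef := hP.mul_mul_conjTranspose_same S
  have htr : (Z * P).trace = (S * P * Sᴴ).trace := by
    rw [hS, Matrix.trace_mul_comm (S * P), Matrix.mul_assoc]
  refine ⟨htr ▸ hpsd.trace_nonneg, fun h => ?_⟩
  have h0 : S * P * Sᴴ = 0 := hpsd.trace_eq_zero_iff.mp (htr ▸ h)
  have hSu' : IsUnit Sᴴ := hSu.star
  rw [hSu'.mul_left_eq_zero, hSu.mul_right_eq_zero] at h0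
  exact h0

lemma eq_zero_of_transpose_mul_mul_eq_zero {n : ℕ} {Q E : Matrix (Fin n) (Fin n) ℝ}
    (hQ : Q.PosDef) (h : Eᵀ * Q * E = 0) : E = 0 := by
  refine Matrix.ext_of_mulVec_single fun j => ?_
  by_contra hne
  have hne' : E *ᵥ Pi.single j 1 ≠ 0 := fun h0 => hne (by rw [h0, Matrix.zero_mulVec])
  have hpos := hQ.dotProduct_mulVec_pos hne'
  have : star (E *ᵥ Pi.single j 1) ⬝ᵥ (Q *ᵥ (E *ᵥ Pi.single j 1))
      = Pi.single j 1 ⬝ᵥ ((Eᵀ * Q * E) *ᵥ Pi.single j 1) := by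
    rw [← Matrix.mulVec_mulVec, ← Matrix.mulVec_mulVec, Matrix.dotProduct_mulVec _ Eᵀ,
      Matrix.vecMul_transpose]
    rfl
  rw [this, h] at hpos
  simp at hpos

/-- A Sylvester equation whose two coefficients have strict quadratic Lyapunov functions `X`
and `Y` has only the zero solution: pair the equation with `Y⁻¹ Δᵀ X⁻¹` under the trace. -/
lemma sylvester_eq_zero {n : ℕ} {A₁ A₂ X Y Q₁ Q₂ Δ : Matrix (Fin n) (Fin n) ℝ}
    (hX : X.PosDef) (hY : Y.PosDef) (hQ₁ : Q₁.PosDef) (hQ₂ : Q₂.PosDef)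
    (h₁ : A₁ᵀ * X + X * A₁ = -Q₁) (h₂ : A₂ᵀ * Y + Y * A₂ = -Q₂)
    (h : A₁ᵀ * Δ + Δ * A₂ = 0) : Δ = 0 := by
  have hXs : Xᵀ = X := hX.isHermitian
  have hYs : Yᵀ = Y := hY.isHermitian
  have hXd : IsUnit X.det := (Matrix.isUnit_iff_isUnit_det X).mp hX.isUnit
  have hYd : IsUnit Y.det := (Matrix.isUnit_iff_isUnit_det Y).mp hY.isUnit
  obtain ⟨E, rfl⟩ : ∃ E, Δ = X * E * Y :=
    ⟨X⁻¹ * Δ * Y⁻¹, by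
      rw [Matrix.mul_assoc X⁻¹, Matrix.mul_nonsing_inv_cancel_left _ _ hXd,
        Matrix.nonsing_inv_mul_cancel_right _ _ hYd]⟩
  have e₁ : (Y * (Eᵀ * Q₁ * E)).trace = -2 * (Eᵀ * (A₁ᵀ * X * E * Y)).trace := by
    have hQ : Q₁ = -(A₁ᵀ * X + X * A₁) := by rw [h₁, neg_neg]
    have a₁ : (Y * (Eᵀ * (A₁ᵀ * X) * E)).trace = (Eᵀ * (A₁ᵀ * X * E * Y)).trace := by
      rw [Matrix.trace_mul_comm]; simp only [Matrix.mul_assoc]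
    have a₂ : (Y * (Eᵀ * (X * A₁) * E)).trace = (Eᵀ * (A₁ᵀ * X * E * Y)).trace := by
      rw [← a₁, ← Matrix.trace_transpose, Matrix.trace_mul_comm Y]
      simp only [Matrix.transpose_mul, Matrix.transpose_transpose, hXs, hYs, Matrix.mul_assoc]
    rw [hQ, Matrix.mul_neg, Matrix.neg_mul, Matrix.mul_neg, Matrix.trace_neg, Matrix.mul_add,
      Matrix.add_mul, Matrix.mul_add, Matrix.trace_add, a₁, a₂]
    ring
  have e₂ : (X * (E * Q₂ * Eᵀ)).trace = -2 * (Eᵀ * (X * E * (Y * A₂))).trace := by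
    have hQ : Q₂ = -(A₂ᵀ * Y + Y * A₂) := by rw [h₂, neg_neg]
    have a₁ : (X * (E * (Y * A₂) * Eᵀ)).trace = (Eᵀ * (X * E * (Y * A₂))).trace := by
      rw [Matrix.trace_mul_comm Eᵀ]; simp only [Matrix.mul_assoc]
    have a₂ : (X * (E * (A₂ᵀ * Y) * Eᵀ)).trace = (Eᵀ * (X * E * (Y * A₂))).trace := by
      rw [← a₁, ← Matrix.trace_transpose, Matrix.trace_mul_comm X]
      simp only [Matrix.transpose_mul, Matrix.transpose_transpose, hXs, hYs, Matrix.mul_assoc]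
    rw [hQ, Matrix.mul_neg, Matrix.neg_mul, Matrix.mul_neg, Matrix.trace_neg, Matrix.mul_add,
      Matrix.add_mul, Matrix.mul_add, Matrix.trace_add, a₁, a₂]
    ring
  have hsum : (Y * (Eᵀ * Q₁ * E)).trace + (X * (E * Q₂ * Eᵀ)).trace = 0 := by
    have := congrArg (fun M => (Eᵀ * M).trace) h
    simp only [Matrix.mul_add, Matrix.trace_add, Matrix.mul_zero, Matrix.trace_zero] at this
    rw [e₁, e₂]
    simp only [Matrix.mul_assoc] at this ⊢
    linarith
  have p₁ := trace_mul_posDef_faithful hY (hQ₁.posSemidef.conjTranspose_mul_mul_same E)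
  have p₂ := trace_mul_posDef_faithful hX (hQ₂.posSemidef.mul_mul_conjTranspose_same E)
  rw [Matrix.conjTranspose_eq_transpose_of_trivial] at p₁ p₂
  have hE : E = 0 :=
    eq_zero_of_transpose_mul_mul_eq_zero hQ₁ (p₁.2 (by linarith [p₁.1, p₂.1]))
  simp [hE]

/-- Positive definiteness is an open condition on symmetric matrices. -/
lemma eventually_posDef {n : ℕ} {A : Matrix (Fin n) (Fin n) ℝ} (hA : A.PosDef) :
    ∀ᶠ M in 𝓝 A, M.IsHermitian → M.PosDef := by
  have hev : ∀ᶠ M in 𝓝 A, ∀ x ∈ Metric.sphere (0 : Fin n → ℝ) 1, 0 < x ⬝ᵥ (M *ᵥ x) := by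
    refine (isCompact_sphere _ _).eventually_forall_of_forall_eventually fun x hx => ?_
    have hcont : Continuous fun z : Matrix (Fin n) (Fin n) ℝ × (Fin n → ℝ) =>
        z.2 ⬝ᵥ (z.1 *ᵥ z.2) := by fun_prop
    have hx0 : x ≠ 0 := by
      rintro rfl
      simp at hx
    have hpos : 0 < x ⬝ᵥ (A *ᵥ x) := hA.dotProduct_mulVec_pos hx0
    exact hcont.continuousAt.eventually (lt_mem_nhds hpos)
  filter_upwards [hev] with M hM hMs
  refine Matrix.PosDef.of_dotProduct_mulVec_pos hMs fun x hx => ?_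
  have hn : ‖x‖ ≠ 0 := norm_ne_zero_iff.mpr hx
  have h := hM (‖x‖⁻¹ • x) (by simp [norm_smul, hn])
  rw [Matrix.mulVec_smul, dotProduct_smul, smul_dotProduct, smul_eq_mul, smul_eq_mul] at h
  have hi : 0 < ‖x‖⁻¹ := by positivity
  exact (pos_of_mul_pos_right ((pos_of_mul_pos_right h hi.le)) hi.le)

/-! ### The algebraic Riccati equation -/

section Riccati

variable {n : ℕ} {B C D X Y : Matrix (Fin n) (Fin n) ℝ}

/-- On the kernel of a solution the equation reduces to `vᵀ D v = 0`, so positivity of `D` makes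
every positive semidefinite solution definite. -/
lemma IsPSDRiccatiSolution.posDef (hD : D.PosDef) (hX : IsPSDRiccatiSolution B C D X) :
    X.PosDef := by
  refine Matrix.PosDef.of_dotProduct_mulVec_pos hX.1.isHermitian fun v hv => ?_
  refine lt_of_le_of_ne (hX.1.dotProduct_mulVec_nonneg v) fun h0 => ?_
  have hXv : X *ᵥ v = 0 := (hX.1.dotProduct_mulVec_zero_iff v).mp h0.symm
  have hvX : v ᵥ* X = 0 := by
    have hXs : Xᵀ = X := hX.1.isHermitian
    rw [← Matrix.mulVec_transpose, hXs, hXv]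
  have hpos : 0 < v ⬝ᵥ (D *ᵥ v) := hD.dotProduct_mulVec_pos hv
  have := congrArg (fun M => v ⬝ᵥ (M *ᵥ v)) hX.2
  simp only [Matrix.add_mulVec, Matrix.sub_mulVec, ← Matrix.mulVec_mulVec, hXv, dotProduct_add,
    dotProduct_sub, Matrix.mulVec_zero, dotProduct_zero, Matrix.zero_mulVec] at this
  rw [Matrix.dotProduct_mulVec v X, hvX] at this
  simp at this
  linarith

/-- The closed loop matrix `B - C X` has the strict Lyapunov function `X`. -/
lemma IsPSDRiccatiSolution.closedLoop (hC : C.PosDef) (hX : IsPSDRiccatiSolution B C D X) :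
    (B - C * X)ᵀ * X + X * (B - C * X) = -(X * C * X + D) := by
  have hXs : Xᵀ = X := hX.1.isHermitian
  have hCs : Cᵀ = C := hC.isHermitian
  have h := hX.2
  rw [Matrix.transpose_sub, Matrix.transpose_mul, hXs, hCs, ← sub_eq_zero]
  rw [← h]
  noncomm_ring

lemma IsPSDRiccatiSolution.posDef_rhs (hC : C.PosDef) (hD : D.PosDef)
    (hX : IsPSDRiccatiSolution B C D X) : (X * C * X + D).PosDef := by
  have hXs : Xᴴ = X := hX.1.isHermitian
  have h := hC.posSemidef.conjTranspose_mul_mul_same X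
  rw [hXs] at h
  exact hD.posSemidef_add h

/-- The difference of two solutions satisfies a Sylvester equation in the two closed loop
matrices. -/
lemma IsPSDRiccatiSolution.unique (hC : C.PosDef) (hD : D.PosDef)
    (hX : IsPSDRiccatiSolution B C D X) (hY : IsPSDRiccatiSolution B C D Y) : X = Y := by
  refine sub_eq_zero.mp (sylvester_eq_zero (hX.posDef hD) (hY.posDef hD)
    (hX.posDef_rhs hC hD) (hY.posDef_rhs hC hD) (hX.closedLoop hC) (hY.closedLoop hC) ?_)
  have hXs : Xᵀ = X := hX.1.isHermitian
  have hCs : Cᵀ = C := hC.isHermitian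
  have h1 := hX.2
  have h2 := hY.2
  rw [Matrix.transpose_sub, Matrix.transpose_mul, hXs, hCs]
  have : (Bᵀ - X * C) * (X - Y) + (X - Y) * (B - C * Y)
    = (Bᵀ * X + X * B - X * C * X + D) - (Bᵀ * Y + Y * B - Y * C * Y + D) := by noncomm_ring
  rw [this, h1, h2, sub_zero]

lemma riccatiSolution_eq (hC : C.PosDef) (hD : D.PosDef) (hX : IsPSDRiccatiSolution B C D X) :
    riccatiSolution B C D = X := by
  have h : ∃! X, IsPSDRiccatiSolution B C D X := ⟨X, hX, fun Y hY => hY.unique hC hD hX⟩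
  rw [riccatiSolution, dif_pos h]
  exact h.choose_spec.1.unique hC hD hX

/-- The left-hand side of the Riccati equation, with the two occurrences of `B` decoupled: the
parameter is `(B₁, B₂, C, D)` and `B₁` stands for `Bᵀ`. -/
def riccatiMap (z : (Matrix (Fin n) (Fin n) ℝ × Matrix (Fin n) (Fin n) ℝ ×
    Matrix (Fin n) (Fin n) ℝ × Matrix (Fin n) (Fin n) ℝ) × Matrix (Fin n) (Fin n) ℝ) :
    Matrix (Fin n) (Fin n) ℝ :=
  z.1.1 * z.2 + z.2 * z.1.2.1 - z.2 * z.1.2.2.1 * z.2 + z.1.2.2.2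

lemma contDiff_riccatiMap : ContDiff ℝ 1 (riccatiMap (n := n)) := by
  unfold riccatiMap
  fun_prop

/-- The partial derivative in `X` is the Sylvester operator of the closed loop matrices. -/
lemma fderiv_riccatiMap_inr (B₁ B₂ H : Matrix (Fin n) (Fin n) ℝ) :
    (fderiv ℝ riccatiMap ((B₁, B₂, C, D), X) ∘L .inr ℝ _ _) H
      = (B₁ - X * C) * H + H * (B₂ - C * X) := by
  have h1 : HasFDerivAt (riccatiMap (n := n)) _ ((B₁, B₂, C, D), X) :=
    ((contDiff_riccatiMap.differentiable one_ne_zero) _).hasFDerivAt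
  -- Compute the partial derivative as the derivative along the line `X + s H`.
  have hp : HasDerivAt (fun s : ℝ => (((B₁, B₂, C, D) : Matrix (Fin n) (Fin n) ℝ × _ × _ × _),
      X + s • H)) ((0, H)) 0 := by
    refine (hasDerivAt_const _ _).prodMk ?_
    simpa using ((hasDerivAt_id (0 : ℝ)).smul_const H).const_add X
  have h2 := HasFDerivAt.comp_hasDerivAt_of_eq (0 : ℝ) h1 hp (by simp)
  have hX : HasDerivAt (fun s : ℝ => X + s • H) H 0 := by
    simpa using ((hasDerivAt_id (0 : ℝ)).smul_const H).const_add X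
  have h3 : HasDerivAt (fun s : ℝ => B₁ * (X + s • H) + (X + s • H) * B₂
      - (X + s • H) * C * (X + s • H) + D) _ 0 :=
    (((hX.const_mul B₁).add (hX.mul_const B₂)).sub ((hX.mul_const C).mul hX)).add_const D
  have h4 := h2.unique h3
  refine (h4.trans ?_)
  simp
  noncomm_ring

/-- **Continuity of the stabilising solution.** Near coefficients for which `C` and `D` are
positive definite and a positive semidefinite solution `X` exists, `riccatiSolution` is continuous
along symmetric `C` and `D`. Existence comes from the implicit function theorem, uniqueness
from `IsPSDRiccatiSolution.unique`. -/
theorem tendsto_riccatiSolution {ι : Type*} {l : Filter ι}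
    {b c d : ι → Matrix (Fin n) (Fin n) ℝ} (hC : C.PosDef) (hD : D.PosDef)
    (hX : IsPSDRiccatiSolution B C D X) (hb : Tendsto b l (𝓝 B)) (hc : Tendsto c l (𝓝 C))
    (hd : Tendsto d l (𝓝 D)) (hcs : ∀ᶠ i in l, (c i).IsHermitian)
    (hds : ∀ᶠ i in l, (d i).IsHermitian) :
    Tendsto (fun i => riccatiSolution (b i) (c i) (d i)) l (𝓝 X) := by
  have hXs : Xᵀ = X := hX.1.isHermitian
  have hCs : Cᵀ = C := hC.isHermitian
  have hXp := hX.posDef hD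
  have hstrict : HasStrictFDerivAt (riccatiMap (n := n))
      (fderiv ℝ riccatiMap ((Bᵀ, B, C, D), X)) ((Bᵀ, B, C, D), X) :=
    contDiff_riccatiMap.contDiffAt.hasStrictFDerivAt one_ne_zero
  have hinj : Function.Injective
      (fderiv ℝ riccatiMap ((Bᵀ, B, C, D), X) ∘L .inr ℝ _ _).toLinearMap := by
    rw [← LinearMap.ker_eq_bot, LinearMap.ker_eq_bot']
    intro H hH
    refine sylvester_eq_zero hXp hXp (hX.posDef_rhs hC hD) (hX.posDef_rhs hC hD)
      (hX.closedLoop hC) (hX.closedLoop hC) ?_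
    have := fderiv_riccatiMap_inr (C := C) (D := D) (X := X) Bᵀ B H
    rw [Matrix.transpose_sub, Matrix.transpose_mul, hXs, hCs, ← this]
    exact hH
  have hinv : (fderiv ℝ riccatiMap ((Bᵀ, B, C, D), X) ∘L .inr ℝ _ _).IsInvertible :=
    ⟨(LinearEquiv.ofInjectiveEndo _ hinj).toContinuousLinearEquiv, by ext1; rfl⟩
  set φ := hstrict.implicitFunctionOfProdDomain hinv with hφ
  have hφt := hstrict.tendsto_implicitFunctionOfProdDomain hinv
  have hφe := hstrict.eventually_apply_implicitFunctionOfProdDomain hinv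
  have hφu := hstrict.eventually_apply_eq_iff_implicitFunctionOfProdDomain hinv
  rw [← hφ] at hφt hφe hφu
  have hzero : riccatiMap ((Bᵀ, B, C, D), X) = 0 := hX.2
  rw [hzero] at hφe hφu
  have hp : Tendsto (fun i => ((b i)ᵀ, b i, c i, d i)) l (𝓝 (Bᵀ, B, C, D)) := by
    have hbt : Tendsto (fun i => (b i)ᵀ) l (𝓝 Bᵀ) :=
      ((continuous_id.matrix_transpose).tendsto B).comp hb
    exact hbt.prodMk_nhds (hb.prodMk_nhds (hc.prodMk_nhds hd))
  have hx : Tendsto (fun i => φ ((b i)ᵀ, b i, c i, d i)) l (𝓝 X) := hφt.comp hp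
  have hxt : Tendsto (fun i => (φ ((b i)ᵀ, b i, c i, d i))ᵀ) l (𝓝 X) := by
    have := ((continuous_id.matrix_transpose).tendsto X).comp hx
    rw [id, hXs] at this
    exact this
  refine hx.congr' ?_
  filter_upwards [hcs, hds, hc.eventually (eventually_posDef hC),
    hd.eventually (eventually_posDef hD), hx.eventually (eventually_posDef hXp),
    hp.eventually hφe, (hp.prodMk_nhds hxt).eventually hφu] with i hcsi hdsi hci hdi hxi hei hui
  set x := φ ((b i)ᵀ, b i, c i, d i)
  -- The transpose of the implicit solution solves the same equation, so it is the same matrix.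
  have hsym : xᵀ = x := by
    refine (hui.mp ?_).symm
    have hcT : (c i)ᵀ = c i := hcsi
    have hdT : (d i)ᵀ = d i := hdsi
    have h := congrArg Matrix.transpose hei
    simp only [riccatiMap, Matrix.transpose_add, Matrix.transpose_sub, Matrix.transpose_mul,
      Matrix.transpose_transpose, Matrix.transpose_zero, hcT, hdT] at h ⊢
    rw [← h]
    noncomm_ring
  have hxs : x.IsHermitian := hsym
  exact (riccatiSolution_eq (hci hcsi) (hdi hdsi) ⟨(hxi hxs).posSemidef, hei⟩).symm

end Riccati

/-! ### The matrix exponential and the pathwise representation of the solution -/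

section Pathwise

variable {n : ℕ} {Θ : Matrix (Fin n) (Fin n) ℝ}

lemma hasDerivAt_matrix_mulVec {M : ℝ → Matrix (Fin n) (Fin n) ℝ} {v : ℝ → Fin n → ℝ}
    {M' : Matrix (Fin n) (Fin n) ℝ} {v' : Fin n → ℝ} {s : ℝ}
    (hM : HasDerivAt M M' s) (hv : HasDerivAt v v' s) :
    HasDerivAt (fun u => M u *ᵥ v u) (M' *ᵥ v s + M s *ᵥ v') s := by
  let β : Matrix (Fin n) (Fin n) ℝ →L[ℝ] (Fin n → ℝ) →L[ℝ] (Fin n → ℝ) :=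
    LinearMap.toContinuousLinearMap
      (LinearMap.toContinuousLinearMap.toLinearMap ∘ₗ Matrix.mulVecBilin ℝ ℝ)
  exact ((β.hasFDerivAt.comp_hasDerivAt s hM).clm_apply hv)

lemma continuous_exp_smul (Θ : Matrix (Fin n) (Fin n) ℝ) :
    Continuous fun u : ℝ => NormedSpace.exp (u • Θ) :=
  continuous_iff_continuousAt.mpr fun u => (hasDerivAt_exp_smul_const' Θ u).continuousAt

/-- For positive definite `Θ` the entries of `e^{uΘ}` decay exponentially as `u → -∞`. -/
lemma exists_abs_exp_le (hΘ : Θ.PosDef) :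
    ∃ K > 0, ∃ lam > 0, ∀ u ≤ (0 : ℝ), ∀ i j,
      |NormedSpace.exp (u • Θ) i j| ≤ K * Real.exp (lam * u) := by
  set Q : Matrix (Fin n) (Fin n) ℝ := (hΘ.1.eigenvectorUnitary).1 with hQ
  set d := hΘ.1.eigenvalues with hd
  have hQQ : Q * star Q = 1 := Unitary.mul_star_self_of_mem hΘ.1.eigenvectorUnitary.2
  have hQi : Q⁻¹ = star Q := Matrix.inv_eq_right_inv hQQ
  have hQu : IsUnit Q := IsUnit.of_mul_eq_one _ hQQ
  have hexp : ∀ u : ℝ, NormedSpace.exp (u • Θ)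
      = Q * Matrix.diagonal (fun k => Real.exp (u * d k)) * star Q := by
    intro u
    have h1 : u • Θ = Q * Matrix.diagonal (fun k => u * d k) * Q⁻¹ := by
      conv_lhs => rw [hΘ.1.spectral_theorem]
      rw [Unitary.conjStarAlgAut_apply, hQi, ← Matrix.smul_mul, ← Matrix.mul_smul,
        ← Matrix.diagonal_smul]
      rfl
    rw [h1, Matrix.exp_conj _ _ hQu, Matrix.exp_diagonal, hQi]
    congr 3
    ext k
    rw [Pi.coe_exp, Real.exp_eq_exp_ℝ]
  obtain ⟨lam, hlam, hle⟩ : ∃ lam > 0, ∀ k, lam ≤ d k := by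
    rcases isEmpty_or_nonempty (Fin n) with h | h
    · exact ⟨1, one_pos, fun k => isEmptyElim k⟩
    · obtain ⟨k, hk⟩ := Finite.exists_min d
      exact ⟨d k, hΘ.eigenvalues_pos k, hk⟩
  refine ⟨1 + ∑ i, ∑ j, ∑ k, |Q i k| * |Q j k|, by positivity, lam, hlam, fun u hu i j => ?_⟩
  rw [hexp u]
  have h2 : (Q * Matrix.diagonal (fun k => Real.exp (u * d k)) * star Q) i j
      = ∑ k, Q i k * Real.exp (u * d k) * Q j k := by
    rw [Matrix.mul_apply]
    refine Finset.sum_congr rfl fun k _ => ?_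
    rw [Matrix.mul_diagonal, Matrix.star_apply, star_trivial]
  rw [h2]
  calc |∑ k, Q i k * Real.exp (u * d k) * Q j k|
      ≤ ∑ k, |Q i k * Real.exp (u * d k) * Q j k| := Finset.abs_sum_le_sum_abs _ _
    _ ≤ ∑ k, |Q i k| * |Q j k| * Real.exp (lam * u) := by
        refine Finset.sum_le_sum fun k _ => ?_
        have : Real.exp (u * d k) ≤ Real.exp (lam * u) :=
          Real.exp_le_exp.mpr (by nlinarith [hle k])
        rw [abs_mul, abs_mul, Real.abs_exp]
        have h3 : 0 ≤ |Q i k| * |Q j k| := by positivity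
        nlinarith
    _ = (∑ k, |Q i k| * |Q j k|) * Real.exp (lam * u) := by rw [Finset.sum_mul]
    _ ≤ _ := by
        gcongr
        have h4 : ∑ k, |Q i k| * |Q j k| ≤ ∑ j, ∑ k, |Q i k| * |Q j k| :=
          Finset.single_le_sum (f := fun j => ∑ k, |Q i k| * |Q j k|)
            (fun _ _ => by positivity) (Finset.mem_univ j)
        have h5 : ∑ j, ∑ k, |Q i k| * |Q j k| ≤ ∑ i, ∑ j, ∑ k, |Q i k| * |Q j k| :=
          Finset.single_le_sum (f := fun i => ∑ j, ∑ k, |Q i k| * |Q j k|)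
            (fun _ _ => by positivity) (Finset.mem_univ i)
        linarith

lemma tendsto_exp_smul_atBot (hΘ : Θ.PosDef) :
    Tendsto (fun u : ℝ => NormedSpace.exp (u • Θ)) atBot (𝓝 0) := by
  obtain ⟨K, -, lam, hlam, h⟩ := exists_abs_exp_le hΘ
  refine tendsto_pi_nhds.mpr fun i => tendsto_pi_nhds.mpr fun j => ?_
  have hz : Tendsto (fun u : ℝ => K * Real.exp (lam * u)) atBot (𝓝 0) := by
    have := (Real.tendsto_exp_atBot.comp (tendsto_id.const_mul_atBot hlam)).const_mul K
    simpa using this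
  refine squeeze_zero_norm' ?_ hz
  filter_upwards [eventually_le_atBot (0 : ℝ)] with u hu
  exact h u hu i j

/-- Variation of constants for a solution `y` of `dy = -Θ y dt + dx`, with the increments of `x`
taken from the base point `t`. -/
lemma sub_exp_mulVec_eq {x y : ℝ → Fin n → ℝ} (hx : Continuous x) (hy : Continuous y)
    (heq : ∀ s t : ℝ, y t - y s = -(Θ *ᵥ ∫ u in s..t, y u) + (x t - x s)) (t s : ℝ) :
    y t - NormedSpace.exp (s • Θ) *ᵥ (y (t + s) - x (t + s) + x t)
      = -(Θ *ᵥ ∫ u in s..0, NormedSpace.exp (u • Θ) *ᵥ (x (t + u) - x t)) := by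
  -- `y - x` is differentiable although neither `y` nor `x` need be.
  have hz : ∀ u, HasDerivAt (fun u => y (t + u) - x (t + u) + x t) (-(Θ *ᵥ y (t + u))) u := by
    intro u
    have h1 : HasDerivAt (fun r => ∫ v in t..r, y v) (y (t + u)) (t + u) :=
      intervalIntegral.integral_hasDerivAt_right (hy.intervalIntegrable _ _)
        (hy.stronglyMeasurableAtFilter _ _) hy.continuousAt
    have h2 : HasDerivAt (fun u => ∫ v in t..(t + u), y v) (y (t + u)) u :=
      h1.comp_const_add t u
    have h3 := hasDerivAt_matrix_mulVec (hasDerivAt_const u Θ) h2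
    rw [Matrix.zero_mulVec, zero_add] at h3
    refine (h3.neg.const_add (y t)).congr_of_eventuallyEq (Eventually.of_forall fun v => ?_)
    have := heq t (t + v)
    show y (t + v) - x (t + v) + x t = y t + -(Θ *ᵥ ∫ v in t..t + v, y v)
    rw [sub_eq_iff_eq_add] at this
    rw [this]
    abel
  have hd : ∀ u ∈ uIcc s 0, HasDerivAt
      (fun u => NormedSpace.exp (u • Θ) *ᵥ (y (t + u) - x (t + u) + x t))
      (-(Θ *ᵥ (NormedSpace.exp (u • Θ) *ᵥ (x (t + u) - x t)))) u := by
    intro u _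
    have h := hasDerivAt_matrix_mulVec (hasDerivAt_exp_smul_const Θ u) (hz u)
    refine h.congr_deriv ?_
    have hcomm : Θ * NormedSpace.exp (u • Θ) = NormedSpace.exp (u • Θ) * Θ :=
      (((Commute.refl Θ).smul_right u).exp_right).eq
    rw [Matrix.mulVec_mulVec, hcomm, Matrix.mulVec_neg, Matrix.mulVec_mulVec, ← sub_eq_add_neg,
      ← Matrix.mulVec_sub, ← Matrix.mulVec_neg]
    congr 1
    abel
  have hc : Continuous fun u => NormedSpace.exp (u • Θ) *ᵥ (x (t + u) - x t) :=
    (continuous_exp_smul Θ).matrix_mulVec (by fun_prop)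
  have hint := intervalIntegral.integral_eq_sub_of_hasDerivAt hd
    ((continuous_const.matrix_mulVec hc).neg.intervalIntegrable _ _)
  have hpull : ∫ u in s..0, -(Θ *ᵥ (NormedSpace.exp (u • Θ) *ᵥ (x (t + u) - x t)))
      = -(Θ *ᵥ ∫ u in s..0, NormedSpace.exp (u • Θ) *ᵥ (x (t + u) - x t)) := by
    rw [intervalIntegral.integral_neg]
    exact congrArg Neg.neg (ContinuousLinearMap.intervalIntegral_comp_comm
      (LinearMap.toContinuousLinearMap Θ.mulVecLin) (hc.intervalIntegrable s 0))
  rw [hpull] at hint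
  rw [hint]
  simp

/-- The stationary solution as a functional of the increments of the noise:
`y_t = -Θ ∫_{-∞}^0 e^{Θ u} (x_{t+u} - x_t) du`. -/
lemma tendsto_integral_exp_increment (hΘ : Θ.PosDef) {x y : ℝ → Fin n → ℝ} (hx : Continuous x)
    (hy : Continuous y) (hx0 : x 0 = 0)
    (heq : ∀ s t : ℝ, y t - y s = -(Θ *ᵥ ∫ u in s..t, y u) + (x t - x s))
    (hinit : HasExpIntegral Θ x 0 (y 0)) (t : ℝ) :
    Tendsto (fun s : ℝ => -(Θ *ᵥ ∫ u in s..0, NormedSpace.exp (u • Θ) *ᵥ (x (t + u) - x t)))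
      atBot (𝓝 (y t)) := by
  have hmv : Continuous fun v : Fin n → ℝ => Θ *ᵥ v := by fun_prop
  -- By variation of constants at base point `0`, the initial condition says exactly that the
  -- boundary term vanishes at `-∞`.
  have hzero : Tendsto (fun s : ℝ => NormedSpace.exp (s • Θ) *ᵥ (y s - x s)) atBot (𝓝 0) := by
    obtain ⟨L, hL, hy0⟩ := hinit
    have h1 : Tendsto (fun s : ℝ => y 0 - -(Θ *ᵥ ∫ u in s..0, NormedSpace.exp (u • Θ) *ᵥ x u))
        atBot (𝓝 (y 0 - -(Θ *ᵥ L))) :=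
      (((hmv.tendsto L).comp hL).neg).const_sub (y 0)
    rw [hy0, hx0, Matrix.mulVec_zero, zero_sub, sub_self] at h1
    refine h1.congr fun s => ?_
    have h2 := sub_exp_mulVec_eq hx hy heq 0 s
    simp only [zero_add, hx0, sub_zero, add_zero] at h2
    rw [← h2, hy0, hx0, Matrix.mulVec_zero, zero_sub]
    abel
  have hshift : Tendsto (fun s : ℝ => NormedSpace.exp (s • Θ) *ᵥ (y (t + s) - x (t + s)))
      atBot (𝓝 0) := by
    have h1 : Tendsto (fun s : ℝ => NormedSpace.exp ((-t) • Θ) *ᵥ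
        (NormedSpace.exp ((t + s) • Θ) *ᵥ (y (t + s) - x (t + s)))) atBot (𝓝 0) := by
      have hc : Continuous fun v : Fin n → ℝ => NormedSpace.exp ((-t) • Θ) *ᵥ v := by fun_prop
      have := (hc.tendsto 0).comp (hzero.comp (tendsto_atBot_add_const_left _ t tendsto_id))
      rwa [Matrix.mulVec_zero] at this
    refine h1.congr fun s => ?_
    rw [Matrix.mulVec_mulVec, ← Matrix.exp_add_of_commute]
    · rw [← add_smul, neg_add_cancel_left]
    · exact ((Commute.refl Θ).smul_right _).smul_left _
  have hconst : Tendsto (fun s : ℝ => NormedSpace.exp (s • Θ) *ᵥ x t) atBot (𝓝 0) := by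
    have hc : Continuous fun M : Matrix (Fin n) (Fin n) ℝ => M *ᵥ x t := by fun_prop
    have := (hc.tendsto 0).comp (tendsto_exp_smul_atBot hΘ)
    rwa [Matrix.zero_mulVec] at this
  have h := (hshift.add hconst).const_sub (y t)
  rw [add_zero, sub_zero] at h
  refine h.congr fun s => ?_
  rw [← sub_exp_mulVec_eq hx hy heq t s, Matrix.mulVec_add]

end Pathwise

/-! ### Strict stationarity of the solution -/

/-- Left-endpoint Riemann sums of a continuous function converge to its integral. -/
lemma tendsto_riemannSum {E : Type*} [NormedAddCommGroup E] [NormedSpace ℝ E] [CompleteSpace E]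
    {f : ℝ → E} (hf : Continuous f) {a b : ℝ} (hab : a ≤ b) :
    Tendsto (fun m : ℕ => ∑ k : Fin m, ((b - a) / m) • f (a + k * ((b - a) / m))) atTop
      (𝓝 (∫ u in a..b, f u)) := by
  rw [Metric.tendsto_atTop]
  intro ε hε
  have huc := isCompact_Icc.uniformContinuousOn_of_continuous (s := Icc a b) hf.continuousOn
  rw [Metric.uniformContinuousOn_iff] at huc
  obtain ⟨δ, hδ, hfδ⟩ := huc (ε / (b - a + 1)) (div_pos hε (by linarith))
  obtain ⟨M, hM⟩ := exists_nat_gt ((b - a) / δ)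
  refine ⟨M + 1, fun m hm => ?_⟩
  have hm0 : (0 : ℝ) < m := by exact_mod_cast (show 0 < m by omega)
  have hMm : (M : ℝ) ≤ m := by exact_mod_cast (show M ≤ m by omega)
  set h := (b - a) / m with hh
  have hh0 : 0 ≤ h := div_nonneg (by linarith) hm0.le
  have hmh : m * h = b - a := by rw [hh]; field_simp
  have hhδ : h < δ := by
    rw [hh, div_lt_iff₀ hm0]
    rw [div_lt_iff₀ hδ] at hM
    nlinarith
  have hsplit : ∫ u in a..b, f u
      = ∑ k ∈ Finset.range m, ∫ u in (a + k * h)..(a + (k + 1 : ℕ) * h), f u := by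
    rw [intervalIntegral.sum_integral_adjacent_intervals (a := fun k : ℕ => a + k * h)
      (fun k _ => hf.intervalIntegrable _ _)]
    rw [hmh]
    simp
  rw [dist_eq_norm, Finset.sum_fin_eq_sum_range, hsplit, ← Finset.sum_sub_distrib]
  have hterm : ∀ k ∈ Finset.range m, ‖(if hk : k < m then h • f (a + (⟨k, hk⟩ : Fin m) * h) else 0)
      - ∫ u in (a + k * h)..(a + (k + 1 : ℕ) * h), f u‖ ≤ ε / (b - a + 1) * h := by
    intro k hk
    have hkm := Finset.mem_range.mp hk
    have hk1 : ((k : ℝ) + 1) ≤ m := by exact_mod_cast hkm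
    have hle : a + k * h ≤ a + (k + 1 : ℕ) * h := by push_cast; nlinarith
    have hlen : a + (k + 1 : ℕ) * h - (a + k * h) = h := by push_cast; ring
    have hc : h • f (a + k * h) = ∫ _ in (a + k * h)..(a + (k + 1 : ℕ) * h), f (a + k * h) := by
      rw [intervalIntegral.integral_const, hlen]
    rw [dif_pos hkm]
    show ‖h • f (a + k * h) - _‖ ≤ _
    rw [hc, ← intervalIntegral.integral_sub (intervalIntegrable_const)
      (hf.intervalIntegrable _ _)]
    have := intervalIntegral.norm_integral_le_of_norm_le_const
      (f := fun u => f (a + k * h) - f u) (C := ε / (b - a + 1))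
      (a := a + k * h) (b := a + (k + 1 : ℕ) * h) (fun u hu => ?_)
    · rwa [hlen, abs_of_nonneg hh0] at this
    · rw [uIoc_of_le hle] at hu
      have hkh : 0 ≤ (k : ℝ) * h := by positivity
      have hub : (k + 1 : ℝ) * h ≤ b - a := by rw [← hmh]; gcongr
      have hu2 := hu.2
      push_cast at hu2
      rw [← dist_eq_norm]
      refine (hfδ _ ⟨by linarith, by nlinarith⟩ _ ⟨by linarith [hu.1], by linarith⟩ ?_).le
      rw [Real.dist_eq, abs_lt]
      constructor <;> nlinarith [hu.1]
  calc _ ≤ ∑ k ∈ Finset.range m, ε / (b - a + 1) * h := norm_sum_le_of_le _ hterm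
    _ = ε / (b - a + 1) * (b - a) := by
        rw [Finset.sum_const, Finset.card_range, nsmul_eq_mul, ← hmh]; ring
    _ < ε := by
        rw [div_mul_eq_mul_div, div_lt_iff₀ (by linarith)]
        nlinarith

/-- Equality in law passes to almost sure limits. -/
lemma identDistrib_of_tendsto_ae {Ω E : Type*} [MeasurableSpace Ω] {P : Measure Ω}
    [IsProbabilityMeasure P] [TopologicalSpace E] [TopologicalSpace.PseudoMetrizableSpace E]
    [MeasurableSpace E] [BorelSpace E] {X Y : ℕ → Ω → E} {x y : Ω → E}
    (h : ∀ m, IdentDistrib (X m) (Y m) P P)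
    (hX : ∀ᵐ ω ∂P, Tendsto (fun m => X m ω) atTop (𝓝 (x ω)))
    (hY : ∀ᵐ ω ∂P, Tendsto (fun m => Y m ω) atTop (𝓝 (y ω))) : IdentDistrib x y P P := by
  have hx := aemeasurable_of_tendsto_metrizable_ae atTop (fun m => (h m).aemeasurable_fst) hX
  have hy := aemeasurable_of_tendsto_metrizable_ae atTop (fun m => (h m).aemeasurable_snd) hY
  refine ⟨hx, hy, ?_⟩
  have := Measure.isProbabilityMeasure_map hx
  have := Measure.isProbabilityMeasure_map hy
  refine ext_of_forall_integral_eq_of_IsFiniteMeasure fun f => ?_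
  have key : ∀ (Z : ℕ → Ω → E) (z : Ω → E), (∀ m, AEMeasurable (Z m) P) →
      (∀ᵐ ω ∂P, Tendsto (fun m => Z m ω) atTop (𝓝 (z ω))) →
      Tendsto (fun m => ∫ ω, f (Z m ω) ∂P) atTop (𝓝 (∫ ω, f (z ω) ∂P)) := by
    intro Z z hZm hZ
    refine tendsto_integral_of_dominated_convergence (fun _ => ‖f‖)
      (fun m => (f.continuous.measurable.comp_aemeasurable (hZm m)).aestronglyMeasurable)
      (integrable_const _) (fun m => Eventually.of_forall fun ω => f.norm_coe_le_norm _) ?_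
    filter_upwards [hZ] with ω hω
    exact (f.continuous.tendsto _).comp hω
  rw [integral_map hx f.continuous.measurable.aestronglyMeasurable,
    integral_map hy f.continuous.measurable.aestronglyMeasurable]
  refine tendsto_nhds_unique (key X x (fun m => (h m).aemeasurable_fst) hX) ?_
  refine (key Y y (fun m => (h m).aemeasurable_snd) hY).congr fun m => ?_
  exact ((h m).comp f.continuous.measurable).integral_eq.symm

section Stationary

variable {n : ℕ} {Ω : Type*} [MeasurableSpace Ω] {P : Measure Ω}
  {Θ : Matrix (Fin n) (Fin n) ℝ} {G U : ℝ → Ω → Fin n → ℝ}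

lemma IsDriver.identDistrib (hG : IsDriver P G) {ι : Type*} [Finite ι] (τ : ι → ℝ) (h : ℝ) :
    IdentDistrib (fun ω k => G (τ k + h) ω - G h ω) (fun ω k => G (τ k) ω - G 0 ω) P P := by
  obtain ⟨m, ⟨e⟩⟩ := Finite.exists_equiv_fin ι
  have hm : Measurable fun (g : Fin m → Fin n → ℝ) (k : ι) => g (e k) :=
    measurable_pi_lambda _ fun k => measurable_pi_apply _
  have := (hG.stationary_increments m (τ ∘ e.symm) h).comp hm
  simpa [Function.comp_def] using this

/-- Left-endpoint Riemann sum with `m` nodes for `∫_a^0 e^{Θ u} (x_{t+u} - x_t) du`. -/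
def incrementSum (Θ : Matrix (Fin n) (Fin n) ℝ) (a : ℝ) (m : ℕ) (x : ℝ → Fin n → ℝ) (t : ℝ) :
    Fin n → ℝ :=
  ∑ k : Fin m, ((0 - a) / m) •
    (NormedSpace.exp ((a + k * ((0 - a) / m)) • Θ) *ᵥ (x (t + (a + k * ((0 - a) / m))) - x t))

lemma tendsto_incrementSum {x : ℝ → Fin n → ℝ} (hx : Continuous x) {a : ℝ} (ha : a ≤ 0) (t : ℝ) :
    Tendsto (fun m => incrementSum Θ a m x t) atTop
      (𝓝 (∫ u in a..0, NormedSpace.exp (u • Θ) *ᵥ (x (t + u) - x t))) := by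
  have hc : Continuous fun u => NormedSpace.exp (u • Θ) *ᵥ (x (t + u) - x t) :=
    (continuous_exp_smul Θ).matrix_mulVec (by fun_prop)
  unfold incrementSum
  exact tendsto_riemannSum hc ha

lemma identDistrib_incrementSum (hG : IsDriver P G) (a : ℝ) (m : ℕ) {κ : Type*} [Finite κ]
    (p : κ → ℝ) (h : ℝ) :
    IdentDistrib (fun ω b => incrementSum Θ a m (fun s => G s ω) (p b + h))
      (fun ω b => incrementSum Θ a m (fun s => G s ω) (p b)) P P := by
  have : Fintype κ := Fintype.ofFinite κ
  -- One node per evaluation point and grid point; `none` marks the base point of an increment.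
  let τ : κ × Option (Fin m) → ℝ := fun q =>
    p q.1 + q.2.elim 0 (fun k => a + k * ((0 - a) / m))
  let Φ : (κ × Option (Fin m) → Fin n → ℝ) → κ → Fin n → ℝ := fun g b =>
    ∑ k : Fin m, ((0 - a) / m) •
      (NormedSpace.exp ((a + k * ((0 - a) / m)) • Θ) *ᵥ (g (b, some k) - g (b, none)))
  have hΦ : Measurable Φ := by
    refine Continuous.measurable ?_
    fun_prop
  have := (hG.identDistrib τ h).comp hΦ
  convert this using 1
  · funext ω b
    simp only [incrementSum, Function.comp_apply, Φ, τ, Option.elim_some, Option.elim_none,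
      add_zero, sub_sub_sub_cancel_right]
    refine Finset.sum_congr rfl fun k _ => ?_
    rw [add_right_comm]
  · funext ω b
    simp only [incrementSum, Function.comp_apply, Φ, τ, Option.elim_some, Option.elim_none,
      add_zero, sub_sub_sub_cancel_right]

lemma IsSolution.ae_tendsto (hΘ : Θ.PosDef) (hG : IsDriver P G) (hU : IsSolution P Θ G U) :
    ∀ᵐ ω ∂P, ∀ t, Tendsto (fun N : ℕ => -(Θ *ᵥ ∫ u in (-(N : ℝ))..0,
      NormedSpace.exp (u • Θ) *ᵥ (G (t + u) ω - G t ω))) atTop (𝓝 (U t ω)) := by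
  filter_upwards [hG.zero, hG.continuous, hU.continuous, hU.equation, hU.initial]
    with ω h0 hGc hUc heq hin t
  exact (tendsto_integral_exp_increment hΘ hGc hUc h0 heq hin t).comp
    (tendsto_neg_atTop_atBot.comp tendsto_natCast_atTop_atTop)

/-- The solution is strictly stationary: it is the almost sure limit of linear functionals of the
increments of the driver. -/
theorem IsSolution.stationary [IsProbabilityMeasure P] (hΘ : Θ.PosDef) (hG : IsDriver P G)
    (hU : IsSolution P Θ G U) {κ : Type*} [Finite κ] (p : κ → ℝ) (h : ℝ) :
    IdentDistrib (fun ω b => U (p b + h) ω) (fun ω b => U (p b) ω) P P := by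
  have : Fintype κ := Fintype.ofFinite κ
  have h1 : ∀ N : ℕ, IdentDistrib
      (fun ω b => ∫ u in (-(N : ℝ))..0,
        NormedSpace.exp (u • Θ) *ᵥ (G (p b + h + u) ω - G (p b + h) ω))
      (fun ω b => ∫ u in (-(N : ℝ))..0,
        NormedSpace.exp (u • Θ) *ᵥ (G (p b + u) ω - G (p b) ω)) P P := by
    intro N
    refine identDistrib_of_tendsto_ae
      (fun m => identDistrib_incrementSum (Θ := Θ) hG (-(N : ℝ)) m p h) ?_ ?_
    all_goals
      filter_upwards [hG.continuous] with ω hω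
      exact tendsto_pi_nhds.mpr fun b => tendsto_incrementSum hω (by simp) _
  have hm : Measurable fun (g : κ → Fin n → ℝ) (b : κ) => -(Θ *ᵥ g b) := by
    refine Continuous.measurable ?_
    fun_prop
  refine identDistrib_of_tendsto_ae (fun N => (h1 N).comp hm) ?_ ?_
  all_goals
    filter_upwards [hU.ae_tendsto hΘ hG] with ω hω
    exact tendsto_pi_nhds.mpr fun b => hω _

end Stationary

/-! ### Square integrability of the solution -/

section SecondMoment

variable {n : ℕ} {Ω : Type*} [MeasurableSpace Ω] {P : Measure Ω}
  {Θ : Matrix (Fin n) (Fin n) ℝ} {G U : ℝ → Ω → Fin n → ℝ}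

lemma IsDriver.eLpNorm_increment (hG : IsDriver P G) (s h : ℝ) (j : Fin n) :
    eLpNorm (fun ω => G (s + h) ω j - G h ω j) 2 P = eLpNorm (fun ω => G s ω j - G 0 ω j) 2 P := by
  have hm : Measurable fun g : Unit → Fin n → ℝ => g () j := by fun_prop
  exact ((hG.identDistrib (fun _ : Unit => s) h).comp hm).eLpNorm_eq 2

/-- The `L²` norm of the driver grows at most linearly. -/
lemma IsDriver.exists_eLpNorm_le (hG : IsDriver P G) :
    ∃ K ≥ 0, ∀ s ≤ 0, ∀ j,
      eLpNorm (fun ω => G s ω j - G 0 ω j) 2 P ≤ ENNReal.ofReal (K * (1 - s)) := by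
  let D : ℝ → Fin n → ℝ≥0∞ := fun s j => eLpNorm (fun ω => G s ω j - G 0 ω j) 2 P
  let K₀ : ℝ≥0∞ := ∑ j, (⨆ s ∈ Icc (0 : ℝ) 1, ∫⁻ ω, ‖G s ω j‖ₑ ^ 2 ∂P) ^ (1 / 2 : ℝ)
  have hK₀ : K₀ ≠ ∞ := by
    refine ENNReal.sum_ne_top.mpr fun j _ => ?_
    exact ENNReal.rpow_ne_top_of_nonneg (by norm_num) (hG.second_moment j).ne
  have hD : ∀ s ∈ Icc (0 : ℝ) 1, ∀ j, D s j ≤ K₀ := by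
    intro s hs j
    have h1 : D s j = eLpNorm (fun ω => G s ω j) 2 P := by
      refine eLpNorm_congr_ae ?_
      filter_upwards [hG.zero] with ω hω
      simp [hω]
    rw [h1, eLpNorm_eq_lintegral_rpow_enorm_toReal (by norm_num) (by norm_num)]
    refine le_trans ?_ (Finset.single_le_sum (f := fun j =>
      (⨆ s ∈ Icc (0 : ℝ) 1, ∫⁻ ω, ‖G s ω j‖ₑ ^ 2 ∂P) ^ (1 / 2 : ℝ))
      (fun _ _ => zero_le) (Finset.mem_univ j))
    simp only [ENNReal.toReal_ofNat, ENNReal.rpow_ofNat]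
    gcongr
    exact le_iSup₂ (f := fun (s : ℝ) (_ : s ∈ Icc (0 : ℝ) 1) => ∫⁻ ω, ‖G s ω j‖ₑ ^ 2 ∂P) s hs
  have hmeas : ∀ s r j, AEStronglyMeasurable (fun ω => G s ω j - G r ω j) P := fun s r j =>
    (((measurable_pi_apply j).comp (hG.measurable s)).sub
      ((measurable_pi_apply j).comp (hG.measurable r))).aestronglyMeasurable
  -- Split off unit increments, each of which has the law of `G 1 - G 0`.
  have hind : ∀ k : ℕ, ∀ s : ℝ, -(k : ℝ) ≤ s → s ≤ 0 → ∀ j, D s j ≤ k * K₀ := by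
    intro k
    induction k with
    | zero =>
      intro s hs1 hs2 j
      have : s = 0 := le_antisymm hs2 (by simpa using hs1)
      subst this
      simp [D]
    | succ k ih =>
      intro s hs1 hs2 j
      push_cast at hs1 ⊢
      rcases le_total (-1) s with h | h
      · have h2 := hG.eLpNorm_increment (-s) s j
        rw [neg_add_cancel] at h2
        have h3 : D s j = D (-s) j := by
          simp only [D]
          rw [← h2, ← eLpNorm_neg]
          congr 1
          funext ω
          simp
        rw [h3]
        calc D (-s) j ≤ K₀ := hD _ ⟨by linarith, by linarith⟩ j
          _ = 1 * K₀ := (one_mul _).symm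
          _ ≤ _ := by gcongr; exact le_add_self
      · have h2 := hG.eLpNorm_increment 1 s j
        have h3 : D s j ≤ D (s + 1) j + D 1 j := by
          simp only [D]
          rw [← h2]
          refine le_trans (le_of_eq ?_) (eLpNorm_sub_le (hmeas (s + 1) 0 j) (hmeas (1 + s) s j)
            (by norm_num))
          congr 1
          funext ω
          simp [add_comm 1 s]
        calc D s j ≤ D (s + 1) j + D 1 j := h3
          _ ≤ k * K₀ + K₀ := by
            gcongr
            · exact ih _ (by linarith) (by linarith) j
            · exact hD 1 ⟨by norm_num, le_rfl⟩ j
          _ = _ := by ring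
  refine ⟨K₀.toReal, ENNReal.toReal_nonneg, fun s hs j => ?_⟩
  have h1 := hind ⌈-s⌉₊ s (by linarith [Nat.le_ceil (-s)]) hs j
  refine h1.trans ?_
  rw [mul_comm, ENNReal.ofReal_mul ENNReal.toReal_nonneg, ENNReal.ofReal_toReal hK₀]
  gcongr
  rw [← ENNReal.ofReal_natCast]
  refine ENNReal.ofReal_le_ofReal ?_
  linarith [Nat.ceil_lt_add_one (show 0 ≤ -s by linarith)]

/-- A bound uniform in the lower endpoint, from an explicit antiderivative. -/
lemma integral_exp_mul_one_sub_le {lam : ℝ} (hlam : 0 < lam) (a : ℝ) (ha : a ≤ 0) :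
    ∫ u in a..0, Real.exp (lam * u) * (1 - u) ≤ 1 / lam + 1 / lam ^ 2 := by
  have hd : ∀ u ∈ uIcc a 0, HasDerivAt
      (fun u => Real.exp (lam * u) * ((1 - u) / lam + 1 / lam ^ 2))
      (Real.exp (lam * u) * (1 - u)) u := by
    intro u _
    have h1 : HasDerivAt (fun u => Real.exp (lam * u)) (Real.exp (lam * u) * lam) u := by
      simpa using ((hasDerivAt_id u).const_mul lam).exp
    have h2 : HasDerivAt (fun u => (1 - u) / lam + 1 / lam ^ 2) (-1 / lam) u := by
      simpa using (((hasDerivAt_id u).const_sub 1).div_const lam).add_const (1 / lam ^ 2)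
    refine (h1.mul h2).congr_deriv ?_
    field_simp
    ring
  rw [intervalIntegral.integral_eq_sub_of_hasDerivAt hd
    (Continuous.intervalIntegrable (by fun_prop) _ _)]
  have : 0 ≤ Real.exp (lam * a) * ((1 - a) / lam + 1 / lam ^ 2) := by
    have : 0 ≤ 1 - a := by linarith
    positivity
  simpa using this

/-- The initial value is square integrable: Minkowski's inequality bounds the Riemann sums, and
Fatou's lemma passes to the two limits. -/
lemma IsSolution.memLp_zero (hΘ : Θ.PosDef) (hG : IsDriver P G) (hU : IsSolution P Θ G U)
    (i : Fin n) : MemLp (fun ω => U 0 ω i) 2 P := by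
  obtain ⟨K, hK, lam, hlam, hexp⟩ := exists_abs_exp_le hΘ
  obtain ⟨K', hK', hinc⟩ := hG.exists_eLpNorm_le
  -- `f u` dominates the `L²` norm of a coordinate of the integrand at `u`, so the `L²` norms of
  -- the Riemann sums are bounded by the Riemann sums of `f`.
  let f : ℝ → ℝ := fun u => n * (K * K') * (Real.exp (lam * u) * (1 - u))
  have hfc : Continuous f := by fun_prop
  let R : ℝ≥0∞ := ENNReal.ofReal (n * (K * K') * (1 / lam + 1 / lam ^ 2))
  have hmeasG : ∀ s r j, AEStronglyMeasurable (fun ω => G s ω j - G r ω j) P := fun s r j =>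
    (((measurable_pi_apply j).comp (hG.measurable s)).sub
      ((measurable_pi_apply j).comp (hG.measurable r))).aestronglyMeasurable
  have hsum : ∀ (N m : ℕ) (j : Fin n),
      (fun ω => incrementSum Θ (-(N : ℝ)) m (fun s => G s ω) 0 j) =
      ∑ k : Fin m, ∑ l : Fin n, (((0 - -(N : ℝ)) / m) * NormedSpace.exp
        ((-(N : ℝ) + k * ((0 - -(N : ℝ)) / m)) • Θ) j l) •
        fun ω => G (-(N : ℝ) + k * ((0 - -(N : ℝ)) / m)) ω l - G 0 ω l := by
    intro N m j
    funext ω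
    simp only [incrementSum, Finset.sum_apply, Pi.smul_apply, zero_add, smul_eq_mul,
      Matrix.mulVec, dotProduct, Pi.sub_apply, Finset.mul_sum, mul_assoc]
  have hRiem : ∀ (N m : ℕ) (j : Fin n),
      eLpNorm (fun ω => incrementSum Θ (-(N : ℝ)) m (fun s => G s ω) 0 j) 2 P ≤
        ENNReal.ofReal (∑ k : Fin m, ((0 - -(N : ℝ)) / m) •
          f (-(N : ℝ) + k * ((0 - -(N : ℝ)) / m))) := by
    intro N m j
    have hstep : 0 ≤ (0 - -(N : ℝ)) / m := by rw [zero_sub, neg_neg]; positivity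
    have hle : ∀ k : Fin m, -(N : ℝ) + k * ((0 - -(N : ℝ)) / m) ≤ 0 := by
      intro k
      have hm : (0 : ℝ) < m := by exact_mod_cast k.pos
      have hk : (k : ℝ) ≤ m := by exact_mod_cast k.is_lt.le
      have : (k : ℝ) * ((0 - -(N : ℝ)) / m) ≤ m * ((0 - -(N : ℝ)) / m) := by gcongr
      rw [mul_div_cancel₀ _ hm.ne'] at this
      linarith
    rw [hsum]
    have hnn : ∀ k : Fin m, 0 ≤ ((0 - -(N : ℝ)) / m) •
        f (-(N : ℝ) + k * ((0 - -(N : ℝ)) / m)) := by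
      intro k
      have : 0 ≤ 1 - (-(N : ℝ) + k * ((0 - -(N : ℝ)) / m)) := by linarith [hle k]
      simp only [f, smul_eq_mul]
      positivity
    rw [ENNReal.ofReal_sum_of_nonneg fun k _ => hnn k]
    refine (eLpNorm_sum_le (fun k _ => Finset.aestronglyMeasurable_sum _ fun l _ =>
      (hmeasG _ _ l).const_smul _) (by norm_num)).trans (Finset.sum_le_sum fun k _ => ?_)
    refine (eLpNorm_sum_le (fun l _ => (hmeasG _ _ l).const_smul _) (by norm_num)).trans ?_
    set u := -(N : ℝ) + k * ((0 - -(N : ℝ)) / m) with hu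
    have hbound : ∀ l ∈ (Finset.univ : Finset (Fin n)),
        eLpNorm ((((0 - -(N : ℝ)) / m) * NormedSpace.exp (u • Θ) j l) •
          fun ω => G u ω l - G 0 ω l) 2 P ≤
        ENNReal.ofReal (((0 - -(N : ℝ)) / m) * (K * Real.exp (lam * u)) * (K' * (1 - u))) := by
      intro l _
      rw [eLpNorm_const_smul, Real.enorm_eq_ofReal_abs, ENNReal.ofReal_mul (by positivity),
        abs_mul, abs_of_nonneg hstep]
      gcongr
      · exact hexp u (hle k) j l
      · exact hinc u (hle k) l
    refine (Finset.sum_le_sum hbound).trans (le_of_eq ?_)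
    rw [Finset.sum_const, Finset.card_univ, Fintype.card_fin, nsmul_eq_mul,
      ← ENNReal.ofReal_natCast, ← ENNReal.ofReal_mul (by positivity)]
    congr 1
    simp only [f, smul_eq_mul]
    ring
  have hJmeas : ∀ (N m : ℕ) (j : Fin n), AEStronglyMeasurable
      (fun ω => incrementSum Θ (-(N : ℝ)) m (fun s => G s ω) 0 j) P := by
    intro N m j
    rw [hsum]
    exact Finset.aestronglyMeasurable_sum _ fun k _ => Finset.aestronglyMeasurable_sum _
      fun l _ => (hmeasG _ _ l).const_smul _
  let J : ℕ → Fin n → Ω → ℝ := fun N j ω =>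
    (∫ u in (-(N : ℝ))..0, NormedSpace.exp (u • Θ) *ᵥ (G (0 + u) ω - G 0 ω)) j
  have hJlim : ∀ (N : ℕ) (j : Fin n), ∀ᵐ ω ∂P, Tendsto
      (fun m => incrementSum Θ (-(N : ℝ)) m (fun s => G s ω) 0 j) atTop (𝓝 (J N j ω)) := by
    intro N j
    filter_upwards [hG.continuous] with ω hω
    exact tendsto_pi_nhds.mp (tendsto_incrementSum hω (by simp) 0) j
  have hJm : ∀ N j, AEStronglyMeasurable (J N j) P := fun N j =>
    aestronglyMeasurable_of_tendsto_ae atTop (fun m => hJmeas N m j) (hJlim N j)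
  have hJ : ∀ N j, eLpNorm (J N j) 2 P ≤ R := by
    intro N j
    refine (Lp.eLpNorm_lim_le_liminf_eLpNorm (fun m => hJmeas N m j) _ (hJlim N j)).trans ?_
    have h1 : Tendsto (fun m : ℕ => ENNReal.ofReal (∑ k : Fin m, ((0 - -(N : ℝ)) / m) •
        f (-(N : ℝ) + k * ((0 - -(N : ℝ)) / m)))) atTop
        (𝓝 (ENNReal.ofReal (∫ u in (-(N : ℝ))..0, f u))) :=
      ENNReal.tendsto_ofReal (tendsto_riemannSum hfc (by simp))
    refine (liminf_le_liminf (Eventually.of_forall fun m => hRiem N m j)).trans ?_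
    rw [h1.liminf_eq]
    refine ENNReal.ofReal_le_ofReal ?_
    simp only [f]
    rw [intervalIntegral.integral_const_mul]
    gcongr
    exact integral_exp_mul_one_sub_le hlam _ (by simp)
  let S : ℕ → Ω → ℝ := fun N => -∑ j, Θ i j • J N j
  have hU0 : ∀ᵐ ω ∂P, Tendsto (fun N => S N ω) atTop (𝓝 (U 0 ω i)) := by
    filter_upwards [hU.ae_tendsto hΘ hG] with ω hω
    refine (tendsto_pi_nhds.mp (hω 0) i).congr fun N => ?_
    simp only [S, Pi.neg_apply, Finset.sum_apply, Pi.smul_apply, smul_eq_mul, J, Matrix.mulVec,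
      dotProduct]
  have hSm : ∀ N, AEStronglyMeasurable (S N) P := fun N =>
    (Finset.aestronglyMeasurable_sum _ fun j _ => (hJm N j).const_smul _).neg
  refine ⟨((measurable_pi_apply i).comp (hU.measurable 0)).aestronglyMeasurable, ?_⟩
  refine (Lp.eLpNorm_lim_le_liminf_eLpNorm hSm _ hU0).trans_lt ?_
  have hfin : ∑ j, ‖Θ i j‖ₑ * R < ∞ :=
    ENNReal.sum_lt_top.mpr fun j _ => ENNReal.mul_lt_top enorm_lt_top ENNReal.ofReal_lt_top
  refine lt_of_le_of_lt ?_ hfin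
  have hle : ∀ N, eLpNorm (S N) 2 P ≤ ∑ j, ‖Θ i j‖ₑ * R := by
    intro N
    simp only [S]
    rw [eLpNorm_neg]
    refine (eLpNorm_sum_le (fun j _ => (hJm N j).const_smul _) (by norm_num)).trans ?_
    refine Finset.sum_le_sum fun j _ => ?_
    rw [eLpNorm_const_smul]
    gcongr
    exact hJ N j
  exact (liminf_le_liminf (Eventually.of_forall hle)).trans (by simp)

end SecondMoment

/-! ### Second moments of the solution and the Riccati equation for `Θ` -/

section CrossMoment

variable {n : ℕ} {Ω : Type*} [MeasurableSpace Ω] {P : Measure Ω}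

/-- The matrix `E[X Yᵀ]` of raw mixed second moments. -/
def crossMoment (P : Measure Ω) (X Y : Ω → Fin n → ℝ) : Matrix (Fin n) (Fin n) ℝ :=
  Matrix.of fun i j => ∫ ω, X ω i * Y ω j ∂P

lemma crossMoment_transpose (X Y : Ω → Fin n → ℝ) :
    (crossMoment P X Y)ᵀ = crossMoment P Y X := by
  ext i j
  simp only [crossMoment, Matrix.transpose_apply, Matrix.of_apply, mul_comm]

variable {X Y Z : Ω → Fin n → ℝ}

lemma integrable_mul_of_memLp (hX : ∀ i, MemLp (fun ω => X ω i) 2 P)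
    (hY : ∀ i, MemLp (fun ω => Y ω i) 2 P) (i j : Fin n) :
    Integrable (fun ω => X ω i * Y ω j) P :=
  (hX i).integrable_mul (hY j)

lemma crossMoment_add_left (hX : ∀ i, MemLp (fun ω => X ω i) 2 P)
    (hY : ∀ i, MemLp (fun ω => Y ω i) 2 P) (hZ : ∀ i, MemLp (fun ω => Z ω i) 2 P) :
    crossMoment P (fun ω => X ω + Y ω) Z = crossMoment P X Z + crossMoment P Y Z := by
  ext i j
  simp only [crossMoment, Matrix.add_apply, Matrix.of_apply, Pi.add_apply, add_mul]
  exact integral_add (integrable_mul_of_memLp hX hZ i j) (integrable_mul_of_memLp hY hZ i j)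

lemma crossMoment_sub_left (hX : ∀ i, MemLp (fun ω => X ω i) 2 P)
    (hY : ∀ i, MemLp (fun ω => Y ω i) 2 P) (hZ : ∀ i, MemLp (fun ω => Z ω i) 2 P) :
    crossMoment P (fun ω => X ω - Y ω) Z = crossMoment P X Z - crossMoment P Y Z := by
  ext i j
  simp only [crossMoment, Matrix.sub_apply, Matrix.of_apply, Pi.sub_apply, sub_mul]
  exact integral_sub (integrable_mul_of_memLp hX hZ i j) (integrable_mul_of_memLp hY hZ i j)

lemma crossMoment_mulVec_left (A : Matrix (Fin n) (Fin n) ℝ)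
    (hX : ∀ i, MemLp (fun ω => X ω i) 2 P) (hZ : ∀ i, MemLp (fun ω => Z ω i) 2 P) :
    crossMoment P (fun ω => A *ᵥ X ω) Z = A * crossMoment P X Z := by
  ext i j
  simp only [crossMoment, Matrix.mul_apply, Matrix.of_apply, Matrix.mulVec, dotProduct,
    Finset.sum_mul, mul_assoc]
  rw [integral_finsetSum _ fun k _ => (integrable_mul_of_memLp hX hZ k j).const_mul _]
  simp only [integral_const_mul]

lemma crossMoment_sub_right (hX : ∀ i, MemLp (fun ω => X ω i) 2 P)
    (hY : ∀ i, MemLp (fun ω => Y ω i) 2 P) (hZ : ∀ i, MemLp (fun ω => Z ω i) 2 P) :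
    crossMoment P Z (fun ω => X ω - Y ω) = crossMoment P Z X - crossMoment P Z Y := by
  rw [← crossMoment_transpose, crossMoment_sub_left hX hY hZ, Matrix.transpose_sub,
    crossMoment_transpose, crossMoment_transpose]

lemma memLp_mulVec (A : Matrix (Fin n) (Fin n) ℝ) (hX : ∀ i, MemLp (fun ω => X ω i) 2 P)
    (i : Fin n) : MemLp (fun ω => (A *ᵥ X ω) i) 2 P := by
  simp only [Matrix.mulVec, dotProduct]
  exact memLp_finsetSum _ fun k _ => (hX k).const_mul _

/-- `E[(Z + A I)(Z + A I)ᵀ]` expanded. -/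
lemma crossMoment_add_mulVec (A : Matrix (Fin n) (Fin n) ℝ)
    (hX : ∀ i, MemLp (fun ω => X ω i) 2 P) (hZ : ∀ i, MemLp (fun ω => Z ω i) 2 P) :
    crossMoment P (fun ω => Z ω + A *ᵥ X ω) (fun ω => Z ω + A *ᵥ X ω) =
      crossMoment P Z Z + (crossMoment P X Z)ᵀ * Aᵀ + A * crossMoment P X Z
        + A * crossMoment P X X * Aᵀ := by
  have hA := memLp_mulVec A hX
  have hS : ∀ i, MemLp (fun ω => (Z ω + A *ᵥ X ω) i) 2 P := fun i => (hZ i).add (hA i)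
  have h1 : ∀ W : Ω → Fin n → ℝ, (∀ i, MemLp (fun ω => W ω i) 2 P) →
      crossMoment P W (fun ω => Z ω + A *ᵥ X ω)
        = crossMoment P W Z + crossMoment P W X * Aᵀ := by
    intro W hW
    rw [← crossMoment_transpose, crossMoment_add_left hZ hA hW, crossMoment_mulVec_left A hX hW,
      Matrix.transpose_add, Matrix.transpose_mul, crossMoment_transpose, crossMoment_transpose]
  rw [crossMoment_add_left hZ hA hS, crossMoment_mulVec_left A hX hS, h1 Z hZ, h1 X hX,
    crossMoment_transpose]
  noncomm_ring

lemma covMatrix_eq_crossMoment (hX : ∀ i, ∫ ω, X ω i ∂P = 0) :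
    covMatrix P X = crossMoment P X X := by
  ext i j
  simp only [covMatrix, crossMoment, Matrix.of_apply, covariance, hX, sub_zero]

end CrossMoment

/-- A process with everywhere continuous paths and square integrable values whose mixed second
moments are invariant under time shifts. -/
structure IsWideSenseStationary {n : ℕ} {Ω : Type*} [MeasurableSpace Ω] (P : Measure Ω)
    (V : ℝ → Ω → Fin n → ℝ) : Prop where
  measurable : ∀ t, Measurable (V t)
  continuous : ∀ ω, Continuous fun t => V t ω
  memLp : ∀ t i, MemLp (fun ω => V t ω i) 2 P
  shift : ∀ s r h, crossMoment P (V (s + h)) (V (r + h)) = crossMoment P (V s) (V r)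

/-- Integrability on a product with a finite first factor, from a uniform bound on the
sections. -/
lemma integrable_prod_of_integral_norm_le {α Ω : Type*} [MeasurableSpace α] [MeasurableSpace Ω]
    {μ : Measure α} [IsFiniteMeasure μ] {P : Measure Ω} [SFinite P] {f : α × Ω → ℝ}
    (hf : Measurable f) (hi : ∀ x, Integrable (fun ω => f (x, ω)) P) {m : ℝ}
    (hm : ∀ x, ∫ ω, ‖f (x, ω)‖ ∂P ≤ m) : Integrable f (μ.prod P) := by
  refine (integrable_prod_iff hf.aestronglyMeasurable).mpr ⟨Eventually.of_forall hi, ?_⟩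
  have hmeas : StronglyMeasurable fun x => ∫ ω, ‖f (x, ω)‖ ∂P :=
    StronglyMeasurable.integral_prod_right (f := fun x ω => ‖f (x, ω)‖)
      hf.norm.stronglyMeasurable
  refine Integrable.of_bound hmeas.aestronglyMeasurable m (Eventually.of_forall fun x => ?_)
  rw [Real.norm_of_nonneg (integral_nonneg fun _ => norm_nonneg _)]
  exact hm x

/-- The integrated process `∫_0^t V_s ds`, one coordinate at a time. -/
def pathIntegral {n : ℕ} {Ω : Type*} (V : ℝ → Ω → Fin n → ℝ) (t : ℝ) (ω : Ω) : Fin n → ℝ :=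
  fun i => ∫ s in (0 : ℝ)..t, V s ω i

/-- A product of two path integrals as one integral over the square, ready for Fubini. -/
lemma pathIntegral_mul_eq {n : ℕ} {Ω : Type*} (V : ℝ → Ω → Fin n → ℝ) {t : ℝ} (ht : 0 ≤ t) (ω : Ω) (i j : Fin n) :
    pathIntegral V t ω i * pathIntegral V t ω j =
      ∫ z : ℝ × ℝ, V z.1 ω i * V z.2 ω j
        ∂((volume.restrict (Ioc 0 t)).prod (volume.restrict (Ioc 0 t))) := by
  simp only [pathIntegral, intervalIntegral.integral_of_le ht]
  exact (integral_prod_mul (fun s => V s ω i) (fun s => V s ω j)).symm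

namespace IsWideSenseStationary

variable {n : ℕ} {Ω : Type*} [MeasurableSpace Ω] {P : Measure Ω}
  {V : ℝ → Ω → Fin n → ℝ}

lemma crossMoment_eq (hV : IsWideSenseStationary P V) (s r : ℝ) :
    crossMoment P (V s) (V r) = crossCov P V (s - r) := by
  have h := hV.shift (s - r) 0 r
  rw [sub_add_cancel, zero_add] at h
  exact h

lemma crossCov_neg (hV : IsWideSenseStationary P V) (s : ℝ) :
    crossCov P V (-s) = (crossCov P V s)ᵀ := by
  have h1 := hV.crossMoment_eq 0 s
  have h2 := hV.crossMoment_eq s 0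
  rw [zero_sub] at h1
  rw [sub_zero] at h2
  rw [← h1, ← h2, crossMoment_transpose]

lemma measurable_uncurry (hV : IsWideSenseStationary P V) (i : Fin n) :
    Measurable fun z : ℝ × Ω => V z.1 z.2 i :=
  (measurable_pi_apply i).comp
    (measurable_uncurry_of_continuous_of_measurable (u := V) hV.continuous hV.measurable)

lemma integral_abs_mul_le (hV : IsWideSenseStationary P V) (s r : ℝ) (i j : Fin n) :
    ∫ ω, |V s ω i * V r ω j| ∂P ≤ ∑ k, crossCov P V 0 k k := by
  have hsq : ∀ s i, Integrable (fun ω => V s ω i * V s ω i) P := fun s i =>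
    integrable_mul_of_memLp (hV.memLp s) (hV.memLp s) i i
  have heq : ∀ s i, ∫ ω, V s ω i * V s ω i ∂P = crossCov P V 0 i i := by
    intro s i
    have := hV.crossMoment_eq s s
    rw [sub_self] at this
    exact congrFun (congrFun this i) i
  have hle : ∀ i, crossCov P V 0 i i ≤ ∑ k, crossCov P V 0 k k := fun i =>
    Finset.single_le_sum (f := fun k => crossCov P V 0 k k)
      (fun k _ => by
        rw [← heq 0 k]
        exact integral_nonneg fun ω => mul_self_nonneg _) (Finset.mem_univ i)
  calc ∫ ω, |V s ω i * V r ω j| ∂P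
      ≤ ∫ ω, (1 / 2) * (V s ω i * V s ω i + V r ω j * V r ω j) ∂P := by
        refine integral_mono (integrable_mul_of_memLp (hV.memLp s) (hV.memLp r) i j).abs
          (((hsq s i).add (hsq r j)).const_mul _) fun ω => ?_
        simp only
        rw [abs_le]
        constructor <;> nlinarith [sq_nonneg (V s ω i + V r ω j), sq_nonneg (V s ω i - V r ω j)]
    _ = (1 / 2) * (crossCov P V 0 i i + crossCov P V 0 j j) := by
        rw [integral_const_mul, integral_add (hsq s i) (hsq r j), heq, heq]
    _ ≤ _ := by linarith [hle i, hle j]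

lemma crossMoment_increment (hV : IsWideSenseStationary P V) (t : ℝ) :
    crossMoment P (fun ω => V t ω - V 0 ω) (fun ω => V t ω - V 0 ω) =
      (2 : ℝ) • crossCov P V 0 - crossCov P V t - (crossCov P V t)ᵀ := by
  have hI : ∀ i, MemLp (fun ω => (V t ω - V 0 ω) i) 2 P := fun i =>
    (hV.memLp t i).sub (hV.memLp 0 i)
  rw [crossMoment_sub_left (hV.memLp t) (hV.memLp 0) hI,
    crossMoment_sub_right (hV.memLp t) (hV.memLp 0) (hV.memLp t),
    crossMoment_sub_right (hV.memLp t) (hV.memLp 0) (hV.memLp 0), hV.crossMoment_eq,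
    hV.crossMoment_eq, hV.crossMoment_eq, hV.crossMoment_eq, sub_self, sub_zero, sub_self,
    zero_sub, hV.crossCov_neg]
  module

variable [IsProbabilityMeasure P]

lemma intervalIntegrable_crossCov (hV : IsWideSenseStationary P V) (a b : ℝ) (i j : Fin n) :
    IntervalIntegrable (fun s => crossCov P V s i j) volume a b := by
  have hm : StronglyMeasurable fun s => crossCov P V s i j :=
    StronglyMeasurable.integral_prod_right (f := fun s ω => V s ω i * V 0 ω j)
      ((hV.measurable_uncurry i).mul (((measurable_pi_apply j).comp
        (hV.measurable 0)).comp measurable_snd)).stronglyMeasurable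
  refine (intervalIntegrable_const (c := ∑ k, crossCov P V 0 k k)).mono_fun
    hm.aestronglyMeasurable (Eventually.of_forall fun s => ?_)
  refine le_trans ?_ (le_abs_self _)
  exact (abs_integral_le_integral_abs).trans (hV.integral_abs_mul_le s 0 i j)

lemma integral_pathIntegral_mul (hV : IsWideSenseStationary P V) {t : ℝ} (ht : 0 ≤ t) (r : ℝ)
    (i j : Fin n) :
    ∫ ω, pathIntegral V t ω i * V r ω j ∂P = ∫ s in (0 : ℝ)..t, crossCov P V (s - r) i j := by
  have hint : Integrable (fun z : ℝ × Ω => V z.1 z.2 i * V r z.2 j)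
      ((volume.restrict (Ioc 0 t)).prod P) :=
    integrable_prod_of_integral_norm_le
      ((hV.measurable_uncurry i).mul (((measurable_pi_apply j).comp
        (hV.measurable r)).comp measurable_snd))
      (fun s => integrable_mul_of_memLp (hV.memLp s) (hV.memLp r) i j)
      (fun s => hV.integral_abs_mul_le s r i j)
  have hswap := integral_integral_swap (f := fun s ω => V s ω i * V r ω j) hint
  simp only [pathIntegral, intervalIntegral.integral_of_le ht]
  simp only [integral_mul_const] at hswap
  rw [← hswap]
  refine integral_congr_ae (Eventually.of_forall fun s => ?_)
  exact congrFun (congrFun (hV.crossMoment_eq s r) i) j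

lemma integrable_square (hV : IsWideSenseStationary P V) (t : ℝ) (i j : Fin n) :
    Integrable (fun z : (ℝ × ℝ) × Ω => V z.1.1 z.2 i * V z.1.2 z.2 j)
      (((volume.restrict (Ioc 0 t)).prod (volume.restrict (Ioc 0 t))).prod P) :=
  integrable_prod_of_integral_norm_le
    (((hV.measurable_uncurry i).comp (measurable_fst.fst.prodMk measurable_snd)).mul
      ((hV.measurable_uncurry j).comp (measurable_fst.snd.prodMk measurable_snd)))
    (fun z => integrable_mul_of_memLp (hV.memLp z.1) (hV.memLp z.2) i j)
    (fun z => hV.integral_abs_mul_le z.1 z.2 i j)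

lemma memLp_pathIntegral (hV : IsWideSenseStationary P V) {t : ℝ} (ht : 0 ≤ t) (i : Fin n) :
    MemLp (fun ω => pathIntegral V t ω i) 2 P := by
  have hm : StronglyMeasurable fun ω => pathIntegral V t ω i := by
    simp only [pathIntegral, intervalIntegral.integral_of_le ht]
    exact StronglyMeasurable.integral_prod_left (f := fun s ω => V s ω i)
      (hV.measurable_uncurry i).stronglyMeasurable
  rw [memLp_two_iff_integrable_sq hm.aestronglyMeasurable]
  refine (hV.integrable_square t i i).integral_prod_right.congr
    (Eventually.of_forall fun ω => ?_)
  simp only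
  rw [sq, pathIntegral_mul_eq V ht]

lemma crossMoment_pathIntegral (hV : IsWideSenseStationary P V) {t : ℝ} (ht : 0 ≤ t) :
    crossMoment P (pathIntegral V t) (pathIntegral V t) = coeffC t (crossCov P V) := by
  ext i j
  have hint := hV.integrable_square t i j
  have hswap := integral_integral_swap
    (f := fun (z : ℝ × ℝ) ω => V z.1 ω i * V z.2 ω j) hint
  have hcov : ∀ z : ℝ × ℝ, ∫ ω, V z.1 ω i * V z.2 ω j ∂P = crossCov P V (z.1 - z.2) i j :=
    fun z => congrFun (congrFun (hV.crossMoment_eq z.1 z.2) i) j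
  have hcint := hint.integral_prod_left
  simp only [hcov] at hswap hcint
  simp only [crossMoment, coeffC, Matrix.of_apply, pathIntegral_mul_eq V ht]
  rw [← hswap, integral_prod _ hcint]
  simp only [intervalIntegral.integral_of_le ht]

lemma crossMoment_pathIntegral_increment (hV : IsWideSenseStationary P V) {t : ℝ} (ht : 0 ≤ t) :
    crossMoment P (pathIntegral V t) (fun ω => V t ω - V 0 ω) = -coeffB t (crossCov P V) := by
  rw [crossMoment_sub_right (hV.memLp t) (hV.memLp 0) (hV.memLp_pathIntegral ht)]
  ext i j
  simp only [crossMoment, coeffB, Matrix.sub_apply, Matrix.neg_apply, Matrix.of_apply]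
  rw [hV.integral_pathIntegral_mul ht, hV.integral_pathIntegral_mul ht,
    intervalIntegral.integral_sub (hV.intervalIntegrable_crossCov 0 t i j)
      (hV.intervalIntegrable_crossCov 0 t j i)]
  have h1 : ∫ s in (0 : ℝ)..t, crossCov P V (s - t) i j
      = ∫ s in (0 : ℝ)..t, crossCov P V s j i := by
    rw [intervalIntegral.integral_comp_sub_right (fun s => crossCov P V s i j) t, zero_sub,
      sub_self]
    have h2 := intervalIntegral.integral_comp_neg (a := 0) (b := t)
      (fun s => crossCov P V s i j)
    rw [neg_zero] at h2
    rw [← h2]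
    simp only [hV.crossCov_neg, Matrix.transpose_apply]
  rw [h1]
  simp only [sub_zero]
  ring

end IsWideSenseStationary

section Solution

variable {n : ℕ} {Ω : Type*} [MeasurableSpace Ω] {P : Measure Ω}
  {Θ : Matrix (Fin n) (Fin n) ℝ} {G U : ℝ → Ω → Fin n → ℝ}

lemma crossCov_congr {V : ℝ → Ω → Fin n → ℝ} (h : ∀ᵐ ω ∂P, ∀ t, V t ω = U t ω) :
    crossCov P V = crossCov P U := by
  funext s
  ext i j
  refine integral_congr_ae ?_
  filter_upwards [h] with ω hω
  rw [hω, hω]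

variable [IsProbabilityMeasure P]

lemma IsSolution.identDistrib_zero (hΘ : Θ.PosDef) (hG : IsDriver P G)
    (hU : IsSolution P Θ G U) (t : ℝ) (i : Fin n) :
    IdentDistrib (fun ω => U t ω i) (fun ω => U 0 ω i) P P := by
  have hm : Measurable fun g : Unit → Fin n → ℝ => g () i := by fun_prop
  have := (hU.stationary hΘ hG (fun _ : Unit => 0) t).comp hm
  simpa [Function.comp_def] using this

lemma IsSolution.memLp (hΘ : Θ.PosDef) (hG : IsDriver P G) (hU : IsSolution P Θ G U) (t : ℝ)
    (i : Fin n) : MemLp (fun ω => U t ω i) 2 P :=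
  (hU.identDistrib_zero hΘ hG t i).memLp_iff.mpr (hU.memLp_zero hΘ hG i)

/-- The solution agrees, simultaneously for all times and almost surely, with a process all of
whose paths are continuous; this supplies joint measurability. -/
lemma IsSolution.exists_modification (hΘ : Θ.PosDef) (hG : IsDriver P G)
    (hU : IsSolution P Θ G U) :
    ∃ V : ℝ → Ω → Fin n → ℝ, IsWideSenseStationary P V ∧ ∀ᵐ ω ∂P, ∀ t, V t ω = U t ω := by
  classical
  set N : Set Ω := toMeasurable P {ω | ¬ Continuous fun t => U t ω} with hN
  have hN0 : P N = 0 := by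
    rw [hN, measure_toMeasurable]
    exact hU.continuous
  have hNm : MeasurableSet N := measurableSet_toMeasurable _ _
  let V : ℝ → Ω → Fin n → ℝ := fun t ω => if ω ∈ N then 0 else U t ω
  have hVU : ∀ᵐ ω ∂P, ∀ t, V t ω = U t ω := by
    have : ∀ᵐ ω ∂P, ω ∉ N := measure_eq_zero_iff_ae_notMem.mp hN0
    filter_upwards [this] with ω hω t
    simp [V, hω]
  refine ⟨V, ⟨fun t => Measurable.ite hNm measurable_const (hU.measurable t), fun ω => ?_,
    fun t i => ?_, fun s r h => ?_⟩, hVU⟩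
  · by_cases hω : ω ∈ N
    · simp only [V, if_pos hω]
      exact continuous_const
    · simp only [V, if_neg hω]
      by_contra hc
      exact hω (subset_toMeasurable _ _ hc)
  · refine (hU.memLp hΘ hG t i).ae_eq ?_
    filter_upwards [hVU] with ω hω
    rw [hω]
  · have hcongr : ∀ s r, crossMoment P (V s) (V r) = crossMoment P (U s) (U r) := by
      intro s r
      ext i j
      refine integral_congr_ae ?_
      filter_upwards [hVU] with ω hω
      rw [hω, hω]
    rw [hcongr, hcongr]
    ext i j
    have hm : Measurable fun g : Bool → Fin n → ℝ => g true i * g false j := by fun_prop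
    exact ((hU.stationary hΘ hG (fun b : Bool => cond b s r) h).comp hm).integral_eq

lemma IsSolution.isCovEstimate_crossCov (hΘ : Θ.PosDef) (hG : IsDriver P G)
    (hU : IsSolution P Θ G U) (t : ℝ) : IsCovEstimate t (crossCov P U) := by
  obtain ⟨V, hV, hVU⟩ := hU.exists_modification hΘ hG
  rw [← crossCov_congr hVU]
  exact ⟨fun i j => hV.intervalIntegrable_crossCov 0 t i j, fun s _ => hV.crossCov_neg s⟩

lemma IsSolution.covMatrix_increment (hΘ : Θ.PosDef) (hG : IsDriver P G)
    (hU : IsSolution P Θ G U) (t : ℝ) :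
    covMatrix P (fun ω => U t ω - U 0 ω) = crossMoment P (fun ω => U t ω - U 0 ω)
      (fun ω => U t ω - U 0 ω) := by
  refine covMatrix_eq_crossMoment fun i => ?_
  have hi : ∀ s, Integrable (fun ω => U s ω i) P := fun s =>
    (hU.memLp hΘ hG s i).integrable (by norm_num)
  simp only [Pi.sub_apply]
  rw [integral_sub (hi t) (hi 0), (hU.identDistrib_zero hΘ hG t i).integral_eq, sub_self]

lemma IsSolution.coeffD_eq (hΘ : Θ.PosDef) (hG : IsDriver P G) (hU : IsSolution P Θ G U)
    (t : ℝ) : coeffD P G U t = estCoeffD P G t (crossCov P U) := by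
  obtain ⟨V, hV, hVU⟩ := hU.exists_modification hΘ hG
  rw [coeffD, estCoeffD, hU.covMatrix_increment hΘ hG, ← crossCov_congr hVU,
    ← hV.crossMoment_increment]
  congr 1
  ext i j
  refine integral_congr_ae ?_
  filter_upwards [hVU] with ω hω
  rw [hω, hω]

/-- `Θ` solves the Riccati equation: take second moments in
`G_t = (U_t - U_0) + Θ ∫_0^t U_s ds`. -/
theorem IsSolution.isPSDRiccatiSolution (hΘ : Θ.PosDef) (hG : IsDriver P G)
    (hU : IsSolution P Θ G U) {t : ℝ} (ht : 0 ≤ t) :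
    IsPSDRiccatiSolution (coeffB t (crossCov P U)) (coeffC t (crossCov P U))
      (coeffD P G U t) Θ := by
  refine ⟨hΘ.posSemidef, ?_⟩
  obtain ⟨V, hV, hVU⟩ := hU.exists_modification hΘ hG
  have hGV : ∀ᵐ ω ∂P, G t ω = (V t ω - V 0 ω) + Θ *ᵥ pathIntegral V t ω := by
    filter_upwards [hG.zero, hU.equation, hVU] with ω h0 heq hω
    have h := heq 0 t
    simp only [← hω, h0, sub_zero] at h
    have hI : ∫ u in (0 : ℝ)..t, V u ω = pathIntegral V t ω := by
      funext i
      exact ((ContinuousLinearMap.proj (R := ℝ) (φ := fun _ : Fin n => ℝ) i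
        ).intervalIntegral_comp_comm ((hV.continuous ω).intervalIntegrable 0 t)).symm
    rw [hI] at h
    rw [h]
    abel
  have hcovG : covMatrix P (G t) = crossMoment P
      (fun ω => (V t ω - V 0 ω) + Θ *ᵥ pathIntegral V t ω)
      (fun ω => (V t ω - V 0 ω) + Θ *ᵥ pathIntegral V t ω) := by
    rw [covMatrix_eq_crossMoment (hG.centred t)]
    ext i j
    refine integral_congr_ae ?_
    filter_upwards [hGV] with ω hω
    rw [hω]
  have hI : ∀ i, MemLp (fun ω => (V t ω - V 0 ω) i) 2 P := fun i =>
    (hV.memLp t i).sub (hV.memLp 0 i)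
  have hΘs : Θᵀ = Θ := hΘ.isHermitian
  rw [hU.coeffD_eq hΘ hG, estCoeffD, ← crossCov_congr hVU, ← hV.crossMoment_increment, hcovG,
    crossMoment_add_mulVec Θ (hV.memLp_pathIntegral ht) hI,
    hV.crossMoment_pathIntegral_increment ht, hV.crossMoment_pathIntegral ht, hΘs,
    Matrix.transpose_neg]
  noncomm_ring

end Solution

/-! ### Continuity of the coefficients in the estimated cross-covariance -/

section Coefficients

variable {n : ℕ} {t e : ℝ} {g γ : ℝ → Matrix (Fin n) (Fin n) ℝ}

lemma abs_apply_le_l2_opNorm (M : Matrix (Fin n) (Fin n) ℝ) (i j : Fin n) : |M i j| ≤ ‖M‖ := by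
  have h := Matrix.l2_opNorm_mulVec M (EuclideanSpace.single j (1 : ℝ))
  rw [PiLp.norm_single, norm_one, mul_one] at h
  refine le_trans ?_ h
  refine le_trans (le_of_eq ?_) (PiLp.norm_apply_le _ i)
  simp

lemma abs_sub_le_supError (he : supError t g γ ≠ ∞) {s : ℝ} (hs : s ∈ Icc 0 t) (i j : Fin n) :
    |g s i j - γ s i j| ≤ (supError t g γ).toReal := by
  refine (abs_apply_le_l2_opNorm (g s - γ s) i j).trans ?_
  rw [← toReal_enorm]
  exact ENNReal.toReal_mono he
    (le_iSup₂ (f := fun (s : ℝ) (_ : s ∈ Icc (0 : ℝ) t) => ‖g s - γ s‖ₑ) s hs)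

namespace IsCovEstimate

lemma abs_sub_le (hg : IsCovEstimate t g) (hγ : IsCovEstimate t γ)
    (he : ∀ s ∈ Icc 0 t, ∀ i j, |g s i j - γ s i j| ≤ e) {s : ℝ} (hs : s ∈ Icc (-t) t)
    (i j : Fin n) : |g s i j - γ s i j| ≤ e := by
  rcases le_total 0 s with h | h
  · exact he s ⟨h, hs.2⟩ i j
  · have hs' : -s ∈ Icc 0 t := ⟨by linarith, by linarith [hs.1]⟩
    have h1 := hg.neg_lag _ hs'
    have h2 := hγ.neg_lag _ hs'
    rw [neg_neg] at h1 h2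
    rw [h1, h2]
    exact he _ hs' j i

lemma intervalIntegrable (hg : IsCovEstimate t g) (ht : 0 ≤ t) (i j : Fin n) :
    IntervalIntegrable (fun s => g s i j) volume (-t) t := by
  refine IntervalIntegrable.trans (b := 0) ?_ (hg.integrable i j)
  rw [IntervalIntegrable.iff_comp_neg, neg_neg, neg_zero]
  refine (IntervalIntegrable.congr ?_ (hg.integrable j i)).symm
  intro s hs
  rw [uIoc_of_le ht] at hs
  simp only
  rw [hg.neg_lag s ⟨hs.1.le, hs.2⟩, Matrix.transpose_apply]

lemma intervalIntegrable_comp_sub (hg : IsCovEstimate t g) (ht : 0 ≤ t) {s : ℝ}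
    (hs : s ∈ Icc 0 t) (i j : Fin n) :
    IntervalIntegrable (fun u => g (s - u) i j) volume 0 t := by
  have h : IntervalIntegrable (fun s => g s i j) volume s (s - t) :=
    (hg.intervalIntegrable ht i j).mono_set (by
      rw [uIcc_of_le (by linarith : -t ≤ t), uIcc_of_ge (by linarith)]
      exact Icc_subset_Icc (by linarith [hs.1]) hs.2)
  simpa using h.comp_sub_left s

lemma intervalIntegrable_integral (hg : IsCovEstimate t g) (ht : 0 ≤ t) (i j : Fin n) :
    IntervalIntegrable (fun s => ∫ u in (0 : ℝ)..t, g (s - u) i j) volume 0 t := by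
  have hI := hg.intervalIntegrable ht i j
  have hcont : ContinuousOn (fun x => ∫ u in (-t)..x, g u i j) (Icc (-t) t) := by
    have := intervalIntegral.continuousOn_primitive_interval (a := -t) (b := t) (μ := volume)
      (f := fun u => g u i j) ?_
    · rwa [uIcc_of_le (by linarith)] at this
    · rwa [uIcc_of_le (by linarith), ← intervalIntegrable_iff_integrableOn_Icc_of_le
        (by linarith)]
  have h1 : ContinuousOn (fun s => (∫ u in (-t)..s, g u i j) - ∫ u in (-t)..(s - t), g u i j)
      (Icc 0 t) := by
    refine (hcont.mono (Icc_subset_Icc (by linarith) le_rfl)).sub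
      (hcont.comp (by fun_prop) fun s hs => ⟨by linarith [hs.1], by linarith [hs.2]⟩)
  have h2 : ContinuousOn (fun s => ∫ u in (0 : ℝ)..t, g (s - u) i j) (Icc 0 t) := by
    refine h1.congr fun s hs => ?_
    have hsub : ∀ x ∈ Icc (-t) t, IntervalIntegrable (fun s => g s i j) volume (-t) x :=
      fun x hx => hI.mono_set (by
        rw [uIcc_of_le hx.1, uIcc_of_le (by linarith : -t ≤ t)]
        exact Icc_subset_Icc le_rfl hx.2)
    beta_reduce
    rw [intervalIntegral.integral_interval_sub_left
      (hsub s ⟨by linarith [hs.1], hs.2⟩) (hsub (s - t) ⟨by linarith [hs.1], by linarith [hs.2]⟩),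
      intervalIntegral.integral_comp_sub_left (fun u => g u i j) s, sub_zero]
  rw [← uIcc_of_le ht] at h2
  exact h2.intervalIntegrable

lemma isHermitian_coeffC (hg : IsCovEstimate t g) (ht : 0 ≤ t) : (coeffC t g).IsHermitian := by
  ext i j
  simp only [Matrix.conjTranspose_apply, star_trivial, coeffC, Matrix.of_apply]
  have h1 : ∀ f : ℝ → ℝ, ∫ s in (0 : ℝ)..t, f s = ∫ s in (0 : ℝ)..t, f (t - s) := by
    intro f
    rw [intervalIntegral.integral_comp_sub_left, sub_self, sub_zero]
  -- Reflecting both variables in `[0, t]` changes the sign of the lag.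
  rw [h1]
  refine intervalIntegral.integral_congr fun s hs => ?_
  rw [h1]
  refine intervalIntegral.integral_congr fun u hu => ?_
  rw [uIcc_of_le ht] at hs hu
  simp only [sub_sub_sub_cancel_left]
  rcases le_total u s with h | h
  · have := hg.neg_lag (s - u) ⟨by linarith, by linarith [hs.2, hu.1]⟩
    rw [neg_sub] at this
    rw [this, Matrix.transpose_apply]
  · have := hg.neg_lag (u - s) ⟨by linarith, by linarith [hu.2, hs.1]⟩
    rw [neg_sub] at this
    rw [this, Matrix.transpose_apply]

lemma isHermitian_estCoeffD {Ω : Type*} [MeasurableSpace Ω] (P : Measure Ω)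
    (G : ℝ → Ω → Fin n → ℝ) (hg : IsCovEstimate t g) (ht : 0 ≤ t) :
    (estCoeffD P G t g).IsHermitian := by
  have h0 : g 0 = (g 0)ᵀ := by simpa using hg.neg_lag 0 ⟨le_rfl, ht⟩
  have hcov : (covMatrix P (G t))ᵀ = covMatrix P (G t) := by
    ext i j
    exact covariance_comm _ _
  show (estCoeffD P G t g)ᵀ = _
  simp only [estCoeffD, Matrix.transpose_sub, Matrix.transpose_smul, Matrix.transpose_transpose,
    hcov, ← h0]
  abel

lemma abs_coeffB_sub_le (hg : IsCovEstimate t g) (hγ : IsCovEstimate t γ) (ht : 0 ≤ t)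
    (he : ∀ s ∈ Icc 0 t, ∀ i j, |g s i j - γ s i j| ≤ e) (i j : Fin n) :
    |coeffB t g i j - coeffB t γ i j| ≤ 2 * e * t := by
  simp only [coeffB, Matrix.of_apply]
  rw [← intervalIntegral.integral_sub ((hg.integrable i j).sub (hg.integrable j i))
    ((hγ.integrable i j).sub (hγ.integrable j i))]
  have h := intervalIntegral.norm_integral_le_of_norm_le_const (a := 0) (b := t) (C := 2 * e)
    (f := fun s => g s i j - g s j i - (γ s i j - γ s j i)) fun s hs => ?_
  · rwa [sub_zero, abs_of_nonneg ht] at h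
  · rw [uIoc_of_le ht] at hs
    have h1 := abs_le.mp (he s ⟨hs.1.le, hs.2⟩ i j)
    have h2 := abs_le.mp (he s ⟨hs.1.le, hs.2⟩ j i)
    rw [Real.norm_eq_abs, abs_le]
    constructor <;> linarith

lemma abs_coeffC_sub_le (hg : IsCovEstimate t g) (hγ : IsCovEstimate t γ) (ht : 0 ≤ t)
    (he : ∀ s ∈ Icc 0 t, ∀ i j, |g s i j - γ s i j| ≤ e) (i j : Fin n) :
    |coeffC t g i j - coeffC t γ i j| ≤ e * t * t := by
  simp only [coeffC, Matrix.of_apply]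
  rw [← intervalIntegral.integral_sub (hg.intervalIntegrable_integral ht i j)
    (hγ.intervalIntegrable_integral ht i j)]
  have h := intervalIntegral.norm_integral_le_of_norm_le_const (a := 0) (b := t) (C := e * t)
    (f := fun s => (∫ u in (0 : ℝ)..t, g (s - u) i j) - ∫ u in (0 : ℝ)..t, γ (s - u) i j)
    fun s hs => ?_
  · rwa [sub_zero, abs_of_nonneg ht] at h
  · rw [uIoc_of_le ht] at hs
    have hs' : s ∈ Icc 0 t := ⟨hs.1.le, hs.2⟩
    rw [← intervalIntegral.integral_sub (hg.intervalIntegrable_comp_sub ht hs' i j)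
      (hγ.intervalIntegrable_comp_sub ht hs' i j)]
    have h := intervalIntegral.norm_integral_le_of_norm_le_const (a := 0) (b := t) (C := e)
      (f := fun u => g (s - u) i j - γ (s - u) i j) fun u hu => ?_
    · rwa [sub_zero, abs_of_nonneg ht] at h
    · rw [uIoc_of_le ht] at hu
      exact hg.abs_sub_le hγ he ⟨by linarith [hs.1, hu.2], by linarith [hs.2, hu.1]⟩ i j

end IsCovEstimate

lemma abs_estCoeffD_sub_le {Ω : Type*} [MeasurableSpace Ω] (P : Measure Ω)
    (G : ℝ → Ω → Fin n → ℝ) (ht : 0 ≤ t)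
    (he : ∀ s ∈ Icc 0 t, ∀ i j, |g s i j - γ s i j| ≤ e) (i j : Fin n) :
    |estCoeffD P G t g i j - estCoeffD P G t γ i j| ≤ 4 * e := by
  have h1 := abs_le.mp (he 0 ⟨le_rfl, ht⟩ i j)
  have h2 := abs_le.mp (he t ⟨ht, le_rfl⟩ i j)
  have h3 := abs_le.mp (he t ⟨ht, le_rfl⟩ j i)
  simp only [estCoeffD, Matrix.sub_apply, Matrix.smul_apply, Matrix.transpose_apply, smul_eq_mul]
  rw [abs_le]
  constructor <;> linarith

lemma tendsto_matrix_of_abs_sub_le {ι : Type*} {l : Filter ι}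
    {f : ι → Matrix (Fin n) (Fin n) ℝ} {M : Matrix (Fin n) (Fin n) ℝ} {e : ι → ℝ}
    (he : Tendsto e l (𝓝 0)) (h : ∀ᶠ k in l, ∀ i j, |f k i j - M i j| ≤ e k) :
    Tendsto f l (𝓝 M) := by
  refine tendsto_pi_nhds.mpr fun i => tendsto_pi_nhds.mpr fun j => ?_
  rw [tendsto_iff_norm_sub_tendsto_zero]
  exact squeeze_zero' (Eventually.of_forall fun _ => norm_nonneg _)
    (h.mono fun k hk => hk i j) he

end Coefficients

/-! ### Consistency of the estimator -/

section Consistency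

variable {n : ℕ} {Ω : Type*} [MeasurableSpace Ω] {P : Measure Ω} [IsProbabilityMeasure P]
  {Θ : Matrix (Fin n) (Fin n) ℝ} {G U : ℝ → Ω → Fin n → ℝ} {t : ℝ}

/-- The estimator is a continuous functional of the estimated cross-covariance at the true
cross-covariance. The statement is deterministic and gives both modes of convergence. -/
theorem tendsto_thetaEstimator (hΘ : Θ.PosDef) (hG : IsDriver P G) (hU : IsSolution P Θ G U)
    (ht : 0 ≤ t) (hC : (coeffC t (crossCov P U)).PosDef) (hD : (coeffD P G U t).PosDef) :
    Tendsto (fun g => ‖thetaEstimator P G t g - Θ‖)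
      (comap (fun g => supError t g (crossCov P U)) (𝓝 0) ⊓ 𝓟 {g | IsCovEstimate t g})
      (𝓝 0) := by
  set l := comap (fun g => supError t g (crossCov P U)) (𝓝 0) ⊓ 𝓟 {g | IsCovEstimate t g}
  have hγ := hU.isCovEstimate_crossCov hΘ hG t
  have hsup : Tendsto (fun g => supError t g (crossCov P U)) l (𝓝 0) :=
    tendsto_comap.mono_left inf_le_left
  have hcov : ∀ᶠ g in l, IsCovEstimate t g := mem_inf_of_right (mem_principal_self _)
  have hfin : ∀ᶠ g in l, supError t g (crossCov P U) ≠ ∞ :=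
    (hsup.eventually (gt_mem_nhds ENNReal.zero_lt_top)).mono fun g hg => ne_of_lt hg
  have he : Tendsto (fun g => (supError t g (crossCov P U)).toReal) l (𝓝 0) := by
    have := (ENNReal.tendsto_toReal ENNReal.zero_ne_top).comp hsup
    exact this
  have hB : Tendsto (fun g => coeffB t g) l (𝓝 (coeffB t (crossCov P U))) := by
    refine tendsto_matrix_of_abs_sub_le (e := fun g =>
      2 * (supError t g (crossCov P U)).toReal * t) (by simpa using (he.const_mul 2).mul_const t) ?_
    filter_upwards [hcov, hfin] with g hg hgf i j
    exact hg.abs_coeffB_sub_le hγ ht (fun s hs => abs_sub_le_supError hgf hs) i j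
  have hCt : Tendsto (fun g => coeffC t g) l (𝓝 (coeffC t (crossCov P U))) := by
    refine tendsto_matrix_of_abs_sub_le (e := fun g =>
      (supError t g (crossCov P U)).toReal * t * t)
      (by simpa using (he.mul_const t).mul_const t) ?_
    filter_upwards [hcov, hfin] with g hg hgf i j
    exact hg.abs_coeffC_sub_le hγ ht (fun s hs => abs_sub_le_supError hgf hs) i j
  have hDt : Tendsto (fun g => estCoeffD P G t g) l (𝓝 (coeffD P G U t)) := by
    rw [hU.coeffD_eq hΘ hG]
    refine tendsto_matrix_of_abs_sub_le (e := fun g =>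
      4 * (supError t g (crossCov P U)).toReal) (by simpa using he.const_mul 4) ?_
    filter_upwards [hfin] with g hgf i j
    exact abs_estCoeffD_sub_le P G ht (fun s hs => abs_sub_le_supError hgf hs) i j
  have h := tendsto_riccatiSolution hC hD (hU.isPSDRiccatiSolution hΘ hG ht) hB hCt hDt
    (hcov.mono fun g hg => hg.isHermitian_coeffC ht)
    (hcov.mono fun g hg => hg.isHermitian_estCoeffD P G ht)
  exact tendsto_iff_norm_sub_tendsto_zero.mp h

end Consistency

end Langevin

end

theorem theorem3 {n : ℕ} {Ω : Type*} [MeasurableSpace Ω] (P : MeasureTheory.Measure Ω)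
    [MeasureTheory.IsProbabilityMeasure P]
    (Θ : Matrix (Fin n) (Fin n) ℝ) (hΘ : Θ.PosDef)
    (G U : ℝ → Ω → Fin n → ℝ)
    (hG : Langevin.IsDriver P G) (hU : Langevin.IsSolution P Θ G U)
    (t : ℝ) (ht : 0 ≤ t)
    (hC : (Langevin.coeffC t (Langevin.crossCov P U)).PosDef)
    (hD : (Langevin.coeffD P G U t).PosDef)
    (γhat : ℝ → Ω → ℝ → Matrix (Fin n) (Fin n) ℝ) :
    ((∀ T > 0, ∀ᵐ ω ∂P, Langevin.IsCovEstimate t (γhat T ω)) →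
      (∀ ε > 0, Tendsto
        (fun T : ℝ => P {ω | ε ≤ Langevin.supError t (γhat T ω) (Langevin.crossCov P U)})
        atTop (𝓝 0)) →
      ∀ ε > 0, Tendsto
        (fun T : ℝ => P {ω | ε ≤ ‖Langevin.thetaEstimator P G t (γhat T ω) - Θ‖})
        atTop (𝓝 0)) ∧
    ((∀ᵐ ω ∂P, ∀ T > 0, Langevin.IsCovEstimate t (γhat T ω)) →
      (∀ᵐ ω ∂P, Tendsto
        (fun T : ℝ => Langevin.supError t (γhat T ω) (Langevin.crossCov P U))
        atTop (𝓝 0)) →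
      ∀ᵐ ω ∂P, Tendsto
        (fun T : ℝ => ‖Langevin.thetaEstimator P G t (γhat T ω) - Θ‖)
        atTop (𝓝 0)) := by
  have key := Langevin.tendsto_thetaEstimator hΘ hG hU ht hC hD
  refine ⟨fun hcov hsup ε hε => ?_, fun hcov hsup => ?_⟩
  · have hev := key.eventually (gt_mem_nhds hε)
    rw [eventually_inf_principal, eventually_comap] at hev
    -- A deterministic `δ` works for every realisation, so the events are nested up to a null set
    -- and no measurability of `γhat` is needed.
    obtain ⟨δ, hδ, hδε⟩ := (ENNReal.nhds_zero_basis.mem_iff).mp hev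
    refine tendsto_of_tendsto_of_tendsto_of_le_of_le' tendsto_const_nhds (hsup δ hδ)
      (Eventually.of_forall fun _ => zero_le) ?_
    filter_upwards [eventually_gt_atTop (0 : ℝ)] with T hT
    refine measure_mono_ae ?_
    filter_upwards [hcov T hT] with ω hω
    intro (hle : ε ≤ _)
    show δ ≤ _
    by_contra! hlt
    exact absurd (hδε (mem_Iio.mpr hlt) _ rfl hω) (not_lt.mpr hle)
  · filter_upwards [hcov, hsup] with ω hω hωs
    refine key.comp (tendsto_inf.mpr ⟨tendsto_comap_iff.mpr hωs, tendsto_principal.mpr ?_⟩)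
    filter_upwards [eventually_gt_atTop (0 : ℝ)] with T hT
    exact hω T hT
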